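/- A \emph{causal graph} is a finite, non-empty directed acyclic graph whose nodes (variables) are partitioned into \emph{exogenous} variables, which have no parents, and \emph{endogenous} variables. The \emph{factor} $f_V$ of a variable $V$ is a factor over $V$ and its parents; for endogenous $V$ it is called the \emph{mechanism} of $V$. Eliminating a variable $X$ from a set of factors replaces all factors that mention $X$ by one factor over the union of their variables without $X$; the factor over the whole union (including $X$) is said to be constructed by this step. The width of an order of all variables is the size (number of variables) of the largest factor constructed by eliminating all variables in this order, minus one, starting from the factors $f_V$; the \emph{treewidth} is the smallest width of an order. A \emph{binary jointree} is a finite tree in which each node is a leaf (one neighbor) or internal (three neighbors), where each leaf hosts one of the factors $f_V$, every factor is hosted by some leaf, and the factor of an exogenous variable is hosted by only one leaf (so that only mechanisms may be replicated); a one-node tree, whose node counts as a leaf, is allowed. The \emph{separator} of an edge is the set of variables that are mentioned both by a factor hosted on one side of the edge and by a factor hosted on the other side. The jointree is \emph{thinned} by removing, in finitely many (possibly zero) successive steps, a variable $X$ from the current separator of an edge $e$, which is allowed if either (1) $X$ is endogenous, and $e$ lies on the path between two leaves that both host the mechanism of $X$ such that the current separators of all edges of this path contain $X$; or (2) some endpoint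 of $e$ is an internal node such that no other edge at this endpoint has $X$ in its current separator. The \emph{cluster} of a leaf is the set of variables of its factor, the cluster of an internal node is the union of the current separators of its edges, and the width of a thinned jointree is the size of its largest cluster minus one. The \emph{causal treewidth} of a causal graph is the smallest width of any thinned binary jointree for it. \textbf{Theorem.} The causal treewidth of every causal graph is at most its treewidth. Moreover, for every integer $n\ge 1$ let $G_n$ be the causal graph with exogenous variables $U_X,U_Y$, endogenous variables $X_i,Y_j,Z_{ij}$ and edges $U_X\to X_i$, $U_Y\to Y_j$, $X_i\to Z_{ij}$, $Y_j\to Z_{ij}$ ($i,j=1,\dots,n$). Then $G_n$ has $n^2+2n+2$ variables, treewidth $n+1$ and causal treewidth $2$. -/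

import Mathlib

/-- The causal graph of a structural causal model with (finitely many) variables `V`:
a directed acyclic graph, given by the inputs (parents) of each variable, in which some variables
are exogenous and have no parents. All other variables are endogenous: each of them is determined
by its parents through a causal mechanism. -/
structure CausalGraph (V : Type*) where
  /-- `x ∈ parents v` means that there is an edge `x → v`. -/
  parents : V → Finset V
  /-- The exogenous variables; the remaining ones are endogenous. -/
  exogenous : Finset V
  parents_exogenous : ∀ u ∈ exogenous, parents u = ∅
  acyclic : ∀ v, ¬ Relation.TransGen (fun x y => x ∈ parents y) v v

namespace CausalGraph

variable {V : Type*} [DecidableEq V]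

/-- The variables of the factor `f_v(v, parents v)` of the variable `v`. -/
def factorVars (G : CausalGraph V) (v : V) : Finset V :=
  insert v (G.parents v)

/-! ### Variable elimination and treewidth -/

/-- Eliminate the variables in the list one after the other, starting from factors over the sets of
variables in `F`. Eliminating `x` multiplies all factors that mention `x`, which constructs a factor
over the union of their variables, and then sums out `x` from this product. The result is the number
of variables of the largest factor that is constructed. -/
def elimSize : List V → Finset (Finset V) → ℕ
  | [], _ => 0
  | x :: order, F =>
      let product : Finset V := (F.filter (fun s => x ∈ s)).sup id
      max product.card
        (elimSize order (insert (product.erase x) (F.filter (fun s => x ∉ s))))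

/-- The width of an elimination order: the largest factor constructed has `width + 1` variables. -/
def orderWidth [Fintype V] (G : CausalGraph V) (order : List V) : ℕ :=
  elimSize order (Finset.univ.image G.factorVars) - 1

/-- The treewidth: the smallest width of an elimination order of all variables. -/
noncomputable def treewidth [Fintype V] (G : CausalGraph V) : ℕ∞ :=
  ⨅ order : {l : List V // l.Nodup ∧ ∀ v, v ∈ l}, (G.orderWidth order.1 : ℕ∞)

/-! ### Binary jointrees -/

/-- A binary jointree with nodes `N` for the causal graph `G`: a tree whose leaves are in one-to-one
correspondence with the factors of `G`, including replicas, and whose other nodes (internal nodes)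
have exactly three neighbors. The factor of every variable occurs; those of endogenous variables
(the mechanisms) can be replicated any number of times, those of exogenous variables cannot.

A leaf has a single neighbor. The one exception is the one-node tree, needed when there is a single
factor: its only node has no neighbor and counts as a leaf (in a tree with at least two nodes every
node has a neighbor). -/
structure BinaryJointree (G : CausalGraph V) (N : Type*) where
  tree : SimpleGraph N
  isTree : tree.IsTree
  /-- `host i = some v` if `i` is a leaf that hosts a copy of the factor of the variable `v`,
  and `host i = none` if `i` is an internal node. -/
  host : N → Option V
  leaf_degree : ∀ i v, host i = some v → (tree.neighborSet i).ncard ≤ 1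
  internal_degree : ∀ i, host i = none → (tree.neighborSet i).ncard = 3
  exists_host : ∀ v, ∃ i, host i = some v
  exogenous_unique : ∀ u ∈ G.exogenous, ∀ i j, host i = some u → host j = some u → i = j

namespace BinaryJointree

variable {G : CausalGraph V} {N : Type*} (T : BinaryJointree G N)

/-- On the side of `i` of the edge `i - j`, some leaf hosts a factor that mentions the variable `x`. -/
def OnSide (i j : N) (x : V) : Prop :=
  ∃ l v, (T.tree.deleteEdges {s(i, j)}).Reachable i l ∧ T.host l = some v ∧ x ∈ G.factorVars v

open Classical in
/-- The separator of an edge in the (unthinned) jointree: the variables that are shared between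
factors on both sides of the edge. -/
noncomputable def sep [Fintype V] (e : Sym2 N) : Finset V :=
  Finset.univ.filter fun x => ∃ i j, e = s(i, j) ∧ T.OnSide i j x ∧ T.OnSide j i x

open Classical in
/-- The cluster of a node, given the (original or thinned) separators `S`: for a leaf the variables
of its factor, for an internal node the union of the separators attached to it. -/
noncomputable def cluster [Fintype V] (S : Sym2 N → Finset V) (i : N) : Finset V :=
  match T.host i with
  | some v => G.factorVars v
  | none => Finset.univ.filter fun x => ∃ j, T.tree.Adj i j ∧ x ∈ S s(i, j)

/-- The width of the jointree with separators `S`: the size of the largest cluster minus one. -/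
noncomputable def width [Fintype V] [Fintype N] (S : Sym2 N → Finset V) : ℕ :=
  (Finset.univ.sup fun i => (T.cluster S i).card) - 1

/-- The variable `x`, which is in the separator of the edge `e`, may be removed from it:

* either `x` is endogenous, `e` lies on the path between two leaves that both host a replica of the
  mechanism of `x`, and all separators on this path contain `x`; so `x` has not been summed out from
  either replica before they meet, and since the mechanism occurs in the factors on both sides of
  `e`, `x` can be summed out on one side: `𝒢 * ℋ = 𝒢 * ∑ x, ℋ` if the mechanism is in `𝒢` and `ℋ`;
* or `e` has an endpoint that is an internal node none of whose other edges has `x` in its separator;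
  then `x` does not occur beyond this endpoint, and there is no need to carry it across `e`. -/
inductive Removable (S : Sym2 N → Finset V) (x : V) (e : Sym2 N) : Prop
  | replicas (a b : N) (p : T.tree.Walk a b) (endogenous : x ∉ G.exogenous)
      (ha : T.host a = some x) (hb : T.host b = some x) (isPath : p.IsPath)
      (mem : e ∈ p.edges) (carried : ∀ e' ∈ p.edges, x ∈ S e')
  | unused (i j : N) (he : e = s(i, j)) (internal : T.host i = none)
      (absent : ∀ k, T.tree.Adj i k → k ≠ j → x ∉ S s(i, k))

/-- One thinning step: a removable variable is removed from the separator of an edge. -/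
def ThinStep [DecidableEq N] (S S' : Sym2 N → Finset V) : Prop :=
  ∃ e ∈ T.tree.edgeSet, ∃ x ∈ S e, T.Removable S x e ∧ S' = Function.update S e ((S e).erase x)

/-- The separators `S` are those of a thinned jointree over `T`: they result from the original ones
by finitely many (possibly no) thinning steps. -/
def IsThinned [Fintype V] [DecidableEq N] (S : Sym2 N → Finset V) : Prop :=
  Relation.ReflTransGen T.ThinStep T.sep S

end BinaryJointree

/-- The causal treewidth: the smallest width of a thinned (finite) binary jointree of `G`. -/
noncomputable def causalTreewidth [Fintype V] (G : CausalGraph V) : ℕ∞ :=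
  sInf {w | ∃ (N : Type) (_ : Fintype N) (_ : DecidableEq N) (T : BinaryJointree G N)
    (S : Sym2 N → Finset V), T.IsThinned S ∧ w = (T.width S : ℕ∞)}

end CausalGraph

/-! ### The family of causal graphs -/

/-- The variables `U_X`, `U_Y`, `X_i`, `Y_j`, `Z_{ij}` for `i, j = 1, …, n`. -/
inductive GridVar (n : ℕ) : Type
  | UX
  | UY
  | X (i : Fin n)
  | Y (j : Fin n)
  | Z (i j : Fin n)
  deriving DecidableEq, Fintype

namespace GridVar

variable {n : ℕ}

/-- The edges are `U_X → X_i`, `U_Y → Y_j`, `X_i → Z_{ij}` and `Y_j → Z_{ij}`. -/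
def parents : GridVar n → Finset (GridVar n)
  | UX => ∅
  | UY => ∅
  | X _ => {UX}
  | Y _ => {UY}
  | Z i j => {X i, Y j}

/-- The length of the longest directed path ending in a variable. -/
def rank : GridVar n → ℕ
  | UX => 0
  | UY => 0
  | X _ => 1
  | Y _ => 1
  | Z _ _ => 2

theorem rank_lt_of_mem_parents {x y : GridVar n} (h : x ∈ y.parents) : x.rank < y.rank := by
  cases y <;> simp [parents] at h
  · subst h; simp [rank]
  · subst h; simp [rank]
  · rcases h with h | h <;> subst h <;> simp [rank]

theorem rank_lt_of_transGen {x y : GridVar n}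
    (h : Relation.TransGen (fun x y : GridVar n => x ∈ y.parents) x y) : x.rank < y.rank := by
  induction h with
  | single h => exact rank_lt_of_mem_parents h
  | tail _ h ih => exact ih.trans (rank_lt_of_mem_parents h)

end GridVar

/-- The causal graph `G_n`, with exogenous variables `U_X`, `U_Y` and endogenous variables
`X_i`, `Y_j`, `Z_{ij}`. -/
def gridGraph (n : ℕ) : CausalGraph (GridVar n) where
  parents := GridVar.parents
  exogenous := {GridVar.UX, GridVar.UY}
  parents_exogenous := by
    intro u hu
    simp only [Finset.mem_insert, Finset.mem_singleton] at hu
    rcases hu with rfl | rfl <;> rfl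
  acyclic := fun _ h => lt_irrefl _ (GridVar.rank_lt_of_transGen h)

/-! For the inequality no thinning is needed. An elimination order is read as a recipe for gluing a
forest: begin with one leaf per factor, and when `x` is eliminated merge, two at a time, all trees
that mention `x`. A variable shared between trees has not been eliminated yet, and the uneliminated
variables of a tree lie in one current factor. Each new internal node therefore has its cluster
inside the factor constructed at that step (`exists_tree_of_order`). The unrooted result is a
jointree in which a cluster consists of the variables occurring in at least two of the three
branches at a node.

For the treewidth of `G_n`, the order `Z`, `UX`, `Y`, then `UY` and the `X` gives factors of at most
`n + 2` variables (`elimSize_le`). Conversely, consider the first `X i` or `Y j` to be eliminated,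
say `X i`. It still shares factors with every `Y j`, and also with `UX` or, if `UX` is gone, with
every `X i'`. The constructed factor has at least `min (n + 2) (2 * n)` variables
(`le_elimSize_of_linked`); `n = 1` is separate.

For the causal treewidth, each `Z i j` gets its own replicas of the mechanisms of `X i` and `Y j`,
in a small block; the blocks hang off a caterpillar with `U_X` and `U_Y` at its ends. Thinning
removes all `X i` and `Y j` from the edges outside the blocks, so only `U_X`, `U_Y` travel along the
caterpillar and clusters have at most 3 variables. The leaf of any `Z i j` already has 3.

That the thinning can be carried out follows from a local criterion (`exists_removable`,
`exists_thinned`). Extend a path of edges from which `x` should disappear as far as possible. An end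
where no further edge carries `x` permits the second rule; if both ends are next to replicas of the
mechanism of `x`, the first rule applies. -/

namespace CausalGraph

/-! ### Bounds for elimination orders -/

section Elimination

variable {V : Type*}

/-- In the set `s`, the elements of rank at least that of `y ∈ s` lie in the bag `C y`. -/
def RankedIn (r : V → ℕ) (C : V → Finset V) (s : Finset V) : Prop :=
  ∀ y ∈ s, ∀ z ∈ s, r y ≤ r z → z ∈ C y

theorem RankedIn.mono {r : V → ℕ} {C : V → Finset V} {s t : Finset V} (h : RankedIn r C t)
    (hst : s ⊆ t) : RankedIn r C s :=
  fun y hy z hz hyz => h y (hst hy) z (hst hz) hyz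

variable [DecidableEq V]

/-- Every factor that mentions a variable to be eliminated is contained in a constructed factor. -/
theorem card_le_elimSize (l : List V) (F : Finset (Finset V)) (s : Finset V) (hs : s ∈ F)
    (h : ∃ x ∈ s, x ∈ l) : s.card ≤ elimSize l F := by
  induction l generalizing F with
  | nil => simp at h
  | cons y l ih =>
    rw [elimSize]
    by_cases hy : y ∈ s
    · refine le_trans (Finset.card_le_card ?_) (le_max_left _ _)
      exact Finset.le_sup (f := id) (Finset.mem_filter.2 ⟨hs, hy⟩)
    · refine le_trans (ih _ ?_ ?_) (le_max_right _ _)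
      · exact Finset.mem_insert_of_mem (Finset.mem_filter.2 ⟨hs, hy⟩)
      · obtain ⟨x, hx, hxl⟩ := h
        refine ⟨x, hx, (List.mem_cons.1 hxl).resolve_left ?_⟩
        rintro rfl
        exact hy hx

/-- A bound on the factors constructed along an order that is sorted by a rank, given bags that
form a perfect elimination scheme. -/
theorem elimSize_le (r : V → ℕ) (C : V → Finset V) (hC : ∀ v, RankedIn r C (C v)) (B : ℕ)
    (hB : ∀ v, (C v).card ≤ B) (l : List V) (hl : l.Pairwise (fun x y => r x ≤ r y))
    (F : Finset (Finset V)) (hF : ∀ s ∈ F, RankedIn r C s ∧ ∀ x ∈ s, x ∈ l) :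
    elimSize l F ≤ B := by
  induction l generalizing F with
  | nil => simp [elimSize]
  | cons x l ih =>
    rw [elimSize]
    rw [List.pairwise_cons] at hl
    -- All remaining variables have rank at least that of `x`, because the order is sorted; so
    -- whatever shares a factor with `x` lies in the bag of `x`.
    have hsub : (F.filter (fun s => x ∈ s)).sup id ⊆ C x := by
      intro z hz
      simp only [Finset.mem_sup, Finset.mem_filter, id] at hz
      obtain ⟨s, ⟨hs, hxs⟩, hzs⟩ := hz
      refine (hF s hs).1 x hxs z hzs ?_
      rcases List.mem_cons.1 ((hF s hs).2 z hzs) with rfl | h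
      · exact le_rfl
      · exact hl.1 z h
    refine max_le ((Finset.card_le_card hsub).trans (hB x)) (ih hl.2 _ ?_)
    intro s hs
    rcases Finset.mem_insert.1 hs with rfl | hs
    · refine ⟨(hC x).mono ((Finset.erase_subset _ _).trans hsub), fun z hz => ?_⟩
      obtain ⟨hzx, hz⟩ := Finset.mem_erase.1 hz
      simp only [Finset.mem_sup, Finset.mem_filter, id] at hz
      obtain ⟨s, ⟨hs, -⟩, hzs⟩ := hz
      exact (List.mem_cons.1 ((hF s hs).2 z hzs)).resolve_left hzx
    · obtain ⟨hs, hxs⟩ := Finset.mem_filter.1 hs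
      refine ⟨(hF s hs).1, fun z hz => (List.mem_cons.1 ((hF s hs).2 z hz)).resolve_left ?_⟩
      rintro rfl
      exact hxs hz

/-- Some factor mentions both variables. -/
def Linked (F : Finset (Finset V)) (a b : V) : Prop := ∃ s ∈ F, a ∈ s ∧ b ∈ s

/-- The factors after the elimination of `x`. -/
def eliminate (x : V) (F : Finset (Finset V)) : Finset (Finset V) :=
  insert (((F.filter (fun s => x ∈ s)).sup id).erase x) (F.filter (fun s => x ∉ s))

theorem Linked.eliminate {F : Finset (Finset V)} {a b x : V} (h : Linked F a b) (ha : a ≠ x)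
    (hb : b ≠ x) : Linked (eliminate x F) a b := by
  obtain ⟨s, hs, has, hbs⟩ := h
  by_cases hx : x ∈ s
  · have : s ⊆ (F.filter (fun s => x ∈ s)).sup id :=
      Finset.le_sup (f := id) (Finset.mem_filter.2 ⟨hs, hx⟩)
    exact ⟨_, Finset.mem_insert_self _ _, Finset.mem_erase.2 ⟨ha, this has⟩,
      Finset.mem_erase.2 ⟨hb, this hbs⟩⟩
  · exact ⟨s, Finset.mem_insert_of_mem (Finset.mem_filter.2 ⟨hs, hx⟩), has, hbs⟩

theorem mem_product_of_linked {F : Finset (Finset V)} {a x : V} (h : Linked F a x) :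
    a ∈ (F.filter (fun s => x ∈ s)).sup id := by
  obtain ⟨s, hs, has, hxs⟩ := h
  exact Finset.le_sup (f := id) (Finset.mem_filter.2 ⟨hs, hxs⟩) has

theorem linked_eliminate_of_linked {F : Finset (Finset V)} {a b x : V} (h : Linked F a x)
    (h' : Linked F b x) (ha : a ≠ x) (hb : b ≠ x) : Linked (eliminate x F) a b :=
  ⟨_, Finset.mem_insert_self _ _, Finset.mem_erase.2 ⟨ha, mem_product_of_linked h⟩,
    Finset.mem_erase.2 ⟨hb, mem_product_of_linked h'⟩⟩

end Elimination

end CausalGraph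

/-! ### Number of variables and treewidth of `G_n` -/

section GridTreewidth

open CausalGraph GridVar

variable {n : ℕ}

theorem card_gridVar (n : ℕ) : Fintype.card (GridVar n) = n ^ 2 + 2 * n + 2 := by
  let e : GridVar n ≃ (Unit ⊕ Unit) ⊕ (Fin n ⊕ Fin n) ⊕ (Fin n × Fin n) :=
    { toFun := fun v => match v with
        | UX => .inl (.inl ())
        | UY => .inl (.inr ())
        | X i => .inr (.inl (.inl i))
        | Y j => .inr (.inl (.inr j))
        | Z i j => .inr (.inr (i, j))
      invFun := fun v => match v with
        | .inl (.inl ()) => UX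
        | .inl (.inr ()) => UY
        | .inr (.inl (.inl i)) => X i
        | .inr (.inl (.inr j)) => Y j
        | .inr (.inr (i, j)) => Z i j
      left_inv := by rintro (_ | _ | _ | _ | _) <;> rfl
      right_inv := by rintro ((_ | _) | (_ | _) | ⟨_, _⟩) <;> rfl }
  rw [Fintype.card_congr e]
  simp only [Fintype.card_sum, Fintype.card_prod, Fintype.card_fin, Fintype.card_unit]
  ring

/-- The rank by which the variables of the grid are eliminated. -/
def gridRank : GridVar n → ℕ
  | UX => 1
  | UY => 3
  | X _ => 3
  | Y _ => 2
  | Z _ _ => 0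

/-- The bags of a perfect elimination scheme for the grid. -/
def gridBag : GridVar n → Finset (GridVar n)
  | UX => insert UX (Finset.univ.image X)
  | UY => insert UY (Finset.univ.image X)
  | X _ => insert UY (Finset.univ.image X)
  | Y j => insert (Y j) (insert UY (Finset.univ.image X))
  | Z i j => {Z i j, X i, Y j}

theorem card_gridBag_le (hn : 1 ≤ n) (v : GridVar n) : (gridBag v).card ≤ n + 2 := by
  have h : (Finset.univ.image (X : Fin n → GridVar n)).card ≤ n :=
    Finset.card_image_le.trans (by simp)
  have h1 : ∀ a : GridVar n, (insert a (Finset.univ.image X)).card ≤ n + 1 :=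
    fun a => (Finset.card_insert_le _ _).trans (by omega)
  cases v with
  | UX => exact (h1 _).trans (by omega)
  | UY => exact (h1 _).trans (by omega)
  | X i => exact (h1 _).trans (by omega)
  | Y j => exact (Finset.card_insert_le _ _).trans (by have := h1 UY; omega)
  | Z i j => exact Finset.card_le_three.trans (by omega)

theorem rankedIn_gridBag (v : GridVar n) : RankedIn gridRank gridBag (gridBag v) := by
  intro y hy z hz
  cases v <;> cases y <;> cases z <;> simp_all [gridBag, gridRank]

theorem factorVars_subset_gridBag (v : GridVar n) :
    ∃ w, (gridGraph n).factorVars v ⊆ gridBag w := by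
  cases v with
  | UX => exact ⟨UX, by simp [factorVars, gridGraph, GridVar.parents, gridBag]⟩
  | UY => exact ⟨UY, by simp [factorVars, gridGraph, GridVar.parents, gridBag]⟩
  | X i =>
    exact ⟨UX, by simp [factorVars, gridGraph, GridVar.parents, gridBag, Finset.insert_subset_iff]⟩
  | Y j =>
    exact ⟨Y j, by simp [factorVars, gridGraph, GridVar.parents, gridBag, Finset.insert_subset_iff]⟩
  | Z i j => exact ⟨Z i j, by simp [factorVars, gridGraph, GridVar.parents, gridBag]⟩

theorem treewidth_gridGraph_le (hn : 1 ≤ n) : (gridGraph n).treewidth ≤ (n + 1 : ℕ) := by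
  let l : List (GridVar n) :=
    (Finset.univ.toList).insertionSort (fun x y => gridRank x ≤ gridRank y)
  have hperm := List.perm_insertionSort (fun x y : GridVar n => gridRank x ≤ gridRank y)
    Finset.univ.toList
  have hmem : ∀ v, v ∈ l := fun v => hperm.mem_iff.2 (by simp)
  have : Std.Total (fun x y : GridVar n => gridRank x ≤ gridRank y) := ⟨fun _ _ => le_total _ _⟩
  have : IsTrans (GridVar n) (fun x y => gridRank x ≤ gridRank y) := ⟨fun _ _ _ => le_trans⟩
  have hsort : l.Pairwise (fun x y => gridRank x ≤ gridRank y) :=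
    List.pairwise_insertionSort _ _
  refine (iInf_le _ ⟨l, hperm.nodup_iff.2 (Finset.nodup_toList _), hmem⟩).trans ?_
  refine Nat.cast_le.2 (Nat.sub_le_of_le_add ?_)
  refine elimSize_le gridRank gridBag rankedIn_gridBag _ (card_gridBag_le hn) l hsort _ ?_
  intro s hs
  obtain ⟨v, -, rfl⟩ := Finset.mem_image.1 hs
  obtain ⟨w, hw⟩ := factorVars_subset_gridBag v
  exact ⟨(rankedIn_gridBag w).mono hw, fun x _ => hmem x⟩

/-- As long as no `X i` and no `Y j` has been eliminated, eliminating the first of them constructs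
a factor with `n + 2` variables. -/
theorem le_elimSize_of_linked (hn : 2 ≤ n) (l : List (GridVar n)) (F : Finset (Finset (GridVar n)))
    (hl : ∀ i, X i ∈ l) (hXY : ∀ i j, Linked F (X i) (Y j))
    (hX : (∀ i, Linked F (X i) UX) ∨ ∀ i i', Linked F (X i) (X i'))
    (hY : (∀ j, Linked F (Y j) UY) ∨ ∀ j j', Linked F (Y j) (Y j')) :
    n + 2 ≤ elimSize l F := by
  have hsymm : ∀ {a b}, Linked F a b → Linked F b a := fun ⟨s, hs, ha, hb⟩ => ⟨s, hs, hb, ha⟩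
  have hcX : (Finset.univ.image (X : Fin n → GridVar n)).card = n := by
    rw [Finset.card_image_of_injective _ (fun a b h => by simpa using h)]; simp
  have hcY : (Finset.univ.image (Y : Fin n → GridVar n)).card = n := by
    rw [Finset.card_image_of_injective _ (fun a b h => by simpa using h)]; simp
  have hdis : Disjoint (Finset.univ.image (X : Fin n → GridVar n)) (Finset.univ.image Y) := by
    simp [Finset.disjoint_left]
  induction l generalizing F with
  | nil => simpa using hl ⟨0, by omega⟩
  | cons x l ih =>
    rw [elimSize]
    -- Eliminating any other variable preserves the hypotheses; eliminating `UX` or `UY` turns the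
    -- first alternative of `hX` or `hY` into the second.
    have hstep : (∀ i, X i ≠ x) → (∀ j, Y j ≠ x) → n + 2 ≤ elimSize l (eliminate x F) := by
      intro hx hy
      refine ih (eliminate x F) (fun i => (List.mem_cons.1 (hl i)).resolve_left (hx i))
        (fun i j => (hXY i j).eliminate (hx i) (hy j)) ?_ ?_
        (fun ⟨s, hs, ha, hb⟩ => ⟨s, hs, hb, ha⟩)
      · rcases hX with hX | hX
        · by_cases h : UX = x
          · subst h
            exact Or.inr fun i i' => linked_eliminate_of_linked (hX i) (hX i') (hx _) (hx _)
          · exact Or.inl fun i => (hX i).eliminate (hx i) h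
        · exact Or.inr fun i i' => (hX i i').eliminate (hx _) (hx _)
      · rcases hY with hY | hY
        · by_cases h : UY = x
          · subst h
            exact Or.inr fun i i' => linked_eliminate_of_linked (hY i) (hY i') (hy _) (hy _)
          · exact Or.inl fun i => (hY i).eliminate (hy i) h
        · exact Or.inr fun i i' => (hY i i').eliminate (hy _) (hy _)
    have hlarge : ∀ s : Finset (GridVar n), n + 2 ≤ s.card →
        s ⊆ (F.filter (fun s => x ∈ s)).sup id →
        n + 2 ≤ ((F.filter (fun s => x ∈ s)).sup id).card :=
      fun s h h' => h.trans (Finset.card_le_card h')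
    -- Here `n ≥ 2` enters, as `2 * n ≥ n + 2`.
    have hXY' : n + 2 ≤ (Finset.univ.image X ∪ Finset.univ.image (Y : Fin n → GridVar n)).card := by
      rw [Finset.card_union_of_disjoint hdis]; omega
    cases x with
    | UX => exact (hstep (by simp) (by simp)).trans (le_max_right _ _)
    | UY => exact (hstep (by simp) (by simp)).trans (le_max_right _ _)
    | Z i j => exact (hstep (by simp) (by simp)).trans (le_max_right _ _)
    | X i =>
      refine le_trans ?_ (le_max_left _ _)
      rcases hX with hX | hX
      · refine hlarge (insert (X i) (insert UX (Finset.univ.image Y))) ?_ ?_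
        · rw [Finset.card_insert_of_notMem (by simp), Finset.card_insert_of_notMem (by simp), hcY]
        · intro a ha
          apply mem_product_of_linked
          simp only [Finset.mem_insert, Finset.mem_image, Finset.mem_univ, true_and] at ha
          rcases ha with rfl | rfl | ⟨j, rfl⟩
          · obtain ⟨s, hs, h, -⟩ := hX i
            exact ⟨s, hs, h, h⟩
          · exact hsymm (hX i)
          · exact hsymm (hXY i j)
      · refine hlarge _ hXY' ?_
        intro a ha
        apply mem_product_of_linked
        simp only [Finset.mem_union, Finset.mem_image, Finset.mem_univ, true_and] at ha
        rcases ha with ⟨i', rfl⟩ | ⟨j, rfl⟩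
        · exact hX i' i
        · exact hsymm (hXY i j)
    | Y j =>
      refine le_trans ?_ (le_max_left _ _)
      rcases hY with hY | hY
      · refine hlarge (insert (Y j) (insert UY (Finset.univ.image X))) ?_ ?_
        · rw [Finset.card_insert_of_notMem (by simp), Finset.card_insert_of_notMem (by simp), hcX]
        · intro a ha
          apply mem_product_of_linked
          simp only [Finset.mem_insert, Finset.mem_image, Finset.mem_univ, true_and] at ha
          rcases ha with rfl | rfl | ⟨i, rfl⟩
          · obtain ⟨s, hs, h, -⟩ := hY j
            exact ⟨s, hs, h, h⟩
          · exact hsymm (hY j)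
          · exact hXY i j
      · refine hlarge _ hXY' ?_
        intro a ha
        apply mem_product_of_linked
        simp only [Finset.mem_union, Finset.mem_image, Finset.mem_univ, true_and] at ha
        rcases ha with ⟨i, rfl⟩ | ⟨j', rfl⟩
        · exact hXY i j
        · exact hY j' j

theorem factorVars_Z (i j : Fin n) :
    (gridGraph n).factorVars (Z i j) = {Z i j, X i, Y j} := rfl

theorem card_factorVars_Z (i j : Fin n) : ((gridGraph n).factorVars (Z i j)).card = 3 := by
  rw [factorVars_Z]
  exact Finset.card_eq_three.2 ⟨_, _, _, by simp, by simp, by simp, rfl⟩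

theorem treewidth_gridGraph (hn : 1 ≤ n) : (gridGraph n).treewidth = n + 1 := by
  refine le_antisymm (by exact_mod_cast treewidth_gridGraph_le hn) ?_
  refine le_iInf fun ⟨l, _, hl⟩ => ?_
  have key : n + 2 ≤ elimSize l (Finset.univ.image (gridGraph n).factorVars) := by
    have hlink : ∀ v, ∀ a ∈ (gridGraph n).factorVars v, ∀ b ∈ (gridGraph n).factorVars v,
        Linked (Finset.univ.image (gridGraph n).factorVars) a b :=
      fun v a ha b hb => ⟨_, Finset.mem_image_of_mem _ (Finset.mem_univ v), ha, hb⟩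
    -- For `n = 1` the union of the `X` and the `Y` is too small, but the factor of `Z 0 0` already
    -- has `n + 2 = 3` variables.
    rcases Nat.lt_or_ge n 2 with h | h
    · obtain rfl : n = 1 := by omega
      rw [show 1 + 2 = ((gridGraph 1).factorVars (Z 0 0)).card from (card_factorVars_Z 0 0).symm]
      exact card_le_elimSize _ _ _ (Finset.mem_image_of_mem _ (Finset.mem_univ _))
        ⟨Z 0 0, Finset.mem_insert_self _ _, hl _⟩
    · refine le_elimSize_of_linked h l _ (fun i => hl _) (fun i j => hlink (Z i j) _ ?_ _ ?_)
        (Or.inl fun i => hlink (X i) _ ?_ _ ?_) (Or.inl fun j => hlink (Y j) _ ?_ _ ?_) <;>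
        simp [factorVars, gridGraph, GridVar.parents]
  have : n + 1 ≤ (gridGraph n).orderWidth l := Nat.le_sub_of_add_le key
  exact_mod_cast this

end GridTreewidth

namespace CausalGraph

namespace BinaryJointree

/-! ### Thinning down to prescribed edges -/

section Thinning

variable {V : Type*} {G : CausalGraph V} {N : Type*} (T : BinaryJointree G N)

/-- A path of edges that carry `x` and are not to be kept can be extended beyond its end, unless it
ends next to a replica of the mechanism of `x` or one of its edges is unused. -/
theorem path_end_cases (S : Sym2 N → Finset V) (x : V) (keep : Sym2 N → Prop)
    (hleaf : ∀ i j, T.tree.Adj i j → ¬ keep s(i, j) → x ∈ S s(i, j) → T.host i = none)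
    (hkeep : ∀ i j k, T.tree.Adj i j → ¬ keep s(i, j) → x ∈ S s(i, j) → T.tree.Adj i k →
      keep s(i, k) → ∃ l, T.tree.Adj i l ∧ T.host l = some x ∧ keep s(i, l) ∧ x ∈ S s(i, l))
    {u v : N} (p : T.tree.Walk u v) (hp : p.IsPath) (hnil : ¬ p.Nil)
    (hedges : ∀ e ∈ p.edges, ¬ keep e ∧ x ∈ S e) :
    (∃ e ∈ T.tree.edgeSet, ¬ keep e ∧ x ∈ S e ∧ T.Removable S x e) ∨
    (∃ (k : N) (h : T.tree.Adj v k),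
      (p.concat h).IsPath ∧ ∀ e ∈ (p.concat h).edges, ¬ keep e ∧ x ∈ S e) ∨
    (∃ l, T.tree.Adj v l ∧ T.host l = some x ∧ keep s(v, l) ∧ x ∈ S s(v, l)) := by
  have hadj := (p.adj_penultimate hnil).symm
  have hmem : s(v, p.penultimate) ∈ p.edges := by
    rw [Sym2.eq_swap]; exact p.mk_penultimate_end_mem_edges hnil
  obtain ⟨hnk, hx⟩ := hedges _ hmem
  have hint := hleaf _ _ hadj hnk hx
  by_cases hk : ∃ k, T.tree.Adj v k ∧ k ≠ p.penultimate ∧ x ∈ S s(v, k)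
  · obtain ⟨k, hvk, hkw, hxk⟩ := hk
    by_cases hkk : keep s(v, k)
    · exact Or.inr (Or.inr (hkeep _ _ _ hadj hnk hx hvk hkk))
    · refine Or.inr (Or.inl ⟨k, hvk, ?_, ?_⟩)
      · rw [SimpleGraph.Walk.concat_isPath_iff]
        -- Returning to the path would close a cycle, except by going back along its last edge.
        refine ⟨hp, fun hks => hkw ?_⟩
        exact T.isTree.isAcyclic.eq_penultimate_of_adj_end hp hvk hks
      · intro e he
        rw [SimpleGraph.Walk.edges_concat, List.concat_eq_append, List.mem_append] at he
        rcases he with he | he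
        · exact hedges e he
        · obtain rfl := List.mem_singleton.1 he
          exact ⟨hkk, hxk⟩
  · push Not at hk
    exact Or.inl ⟨_, hadj, hnk, hx, .unused v p.penultimate rfl hint
      fun k hvk hkw => hk k hvk hkw⟩

/-- Under local conditions on the edges to be kept, as long as another edge carries the endogenous
variable `x`, it can be removed from one of these edges. -/
theorem exists_removable [Fintype N] (S : Sym2 N → Finset V) (x : V) (keep : Sym2 N → Prop)
    (hx : x ∉ G.exogenous)
    (hleaf : ∀ i j, T.tree.Adj i j → ¬ keep s(i, j) → x ∈ S s(i, j) → T.host i = none)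
    (hkeep : ∀ i j k, T.tree.Adj i j → ¬ keep s(i, j) → x ∈ S s(i, j) → T.tree.Adj i k →
      keep s(i, k) → ∃ l, T.tree.Adj i l ∧ T.host l = some x ∧ keep s(i, l) ∧ x ∈ S s(i, l))
    {u v : N} (p : T.tree.Walk u v) (hp : p.IsPath) (hnil : ¬ p.Nil)
    (hedges : ∀ e ∈ p.edges, ¬ keep e ∧ x ∈ S e) :
    ∃ e ∈ T.tree.edgeSet, ¬ keep e ∧ x ∈ S e ∧ T.Removable S x e := by
  -- A path has fewer edges than the tree has nodes, so it can be extended only finitely often.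
  induction hm : Fintype.card N - p.length using Nat.strong_induction_on generalizing u v with
  | _ m ih =>
  have hext : ∀ {u v : N} (p : T.tree.Walk u v) (_ : p.IsPath)
      (_ : Fintype.card N - p.length = m) (k : N) (h : T.tree.Adj v k),
      (p.concat h).IsPath → (∀ e ∈ (p.concat h).edges, ¬ keep e ∧ x ∈ S e) →
      ∃ e ∈ T.tree.edgeSet, ¬ keep e ∧ x ∈ S e ∧ T.Removable S x e := by
    intro u v p hp hm k h hpath hedg
    refine ih _ ?_ (p.concat h) hpath (by simp [← SimpleGraph.Walk.length_eq_zero_iff]) hedg rfl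
    have := hp.length_lt
    rw [SimpleGraph.Walk.length_concat]
    omega
  rcases T.path_end_cases S x keep hleaf hkeep p hp hnil hedges with h | ⟨k, h, h1, h2⟩ | hv
  · exact h
  · exact hext p hp hm k h h1 h2
  rcases T.path_end_cases S x keep hleaf hkeep p.reverse hp.reverse (by simpa using hnil)
      (by simpa using hedges) with h | ⟨k, h, h1, h2⟩ | hu
  · exact h
  · exact hext p.reverse hp.reverse (by simpa using hm) k h h1 h2
  obtain ⟨b, hvb, hb, hkb, hxb⟩ := hv
  obtain ⟨a, hua, ha, hka, hxa⟩ := hu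
  have hmem : s(p.penultimate, v) ∈ p.edges := p.mk_penultimate_end_mem_edges hnil
  -- Both ends are next to replicas, so the path prolonged by these two leaves qualifies for the
  -- first rule. It is a path since all nodes of `p` are internal, and since in a tree a coincidence
  -- of the two leaves would put `b` on `p`.
  have hq : ((SimpleGraph.Walk.cons hua.symm p).concat hvb).IsPath := by
    have hint : ∀ i ∈ p.support, T.host i = none := by
      intro i hi
      obtain ⟨e, he, hie⟩ := (p.mem_support_iff_exists_mem_edges_of_not_nil hnil).1 hi
      obtain ⟨j, rfl⟩ := Sym2.mem_iff_exists.1 hie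
      exact hleaf i j (p.edges_subset_edgeSet he) (hedges _ he).1 (hedges _ he).2
    have hno : ∀ {l}, T.host l = some x → l ∉ p.support := fun h h' => by simp [hint _ h'] at h
    have hcons := hp.cons (hno ha) (h := hua.symm)
    refine hcons.concat (fun h => hno hb ?_) hvb
    have := T.isTree.isAcyclic.eq_penultimate_of_adj_end hcons hvb h
    rw [SimpleGraph.Walk.penultimate_cons_of_not_nil _ _ hnil] at this
    rw [this]
    exact SimpleGraph.Walk.fst_mem_support_of_mem_edges _ hmem
  refine ⟨_, p.edges_subset_edgeSet hmem, (hedges _ hmem).1, (hedges _ hmem).2,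
    .replicas a b _ hx ha hb hq ?_ ?_⟩
  · simp [hmem]
  · intro e he
    simp only [SimpleGraph.Walk.edges_concat, SimpleGraph.Walk.edges_cons, List.concat_eq_append,
      List.mem_append, List.mem_cons, List.not_mem_nil, or_false] at he
    rcases he with (rfl | he) | rfl
    · rwa [Sym2.eq_swap]
    · exact (hedges _ he).2
    · exact hxb

variable [DecidableEq V]

/-- Under local conditions on the edges to be kept, a jointree can be thinned until each variable
is only carried by edges where it is to be kept. -/
theorem exists_thinned [Fintype N] [DecidableEq N] (keep : V → Sym2 N → Prop)
    (S : Sym2 N → Finset V)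
    (hendo : ∀ x, ∀ e ∈ T.tree.edgeSet, ¬ keep x e → x ∈ S e → x ∉ G.exogenous)
    (hleaf : ∀ x i j, T.tree.Adj i j → ¬ keep x s(i, j) → x ∈ S s(i, j) → T.host i = none)
    (hkeep : ∀ x i j k, T.tree.Adj i j → ¬ keep x s(i, j) → x ∈ S s(i, j) → T.tree.Adj i k →
      keep x s(i, k) → ∃ l, T.tree.Adj i l ∧ T.host l = some x ∧ keep x s(i, l) ∧ x ∈ S s(i, l)) :
    ∃ S', Relation.ReflTransGen T.ThinStep S S' ∧
      ∀ e ∈ T.tree.edgeSet, ∀ x ∈ S' e, x ∈ S e ∧ keep x e := by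
  induction hm : ∑ e, (S e).card using Nat.strong_induction_on generalizing S with
  | _ m ih =>
  by_cases hdone : ∀ e ∈ T.tree.edgeSet, ∀ x ∈ S e, keep x e
  · exact ⟨S, .refl, fun e he x hx => ⟨hx, hdone e he x hx⟩⟩
  push Not at hdone
  obtain ⟨e, he, x, hxe, hke⟩ := hdone
  have hrem : ∃ e ∈ T.tree.edgeSet, ¬ keep x e ∧ x ∈ S e ∧ T.Removable S x e := by
    induction e using Sym2.ind with
    | _ u v =>
    have hadj : T.tree.Adj u v := he
    exact T.exists_removable S x (keep x) (hendo x _ he hke hxe) (hleaf x) (hkeep x)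
      hadj.toWalk (by simp [hadj.ne]) (by simp) (by simp [hke, hxe])
  obtain ⟨e, he, hke, hxe, hrem⟩ := hrem
  set S₁ := Function.update S e ((S e).erase x) with hS₁
  have hsub : ∀ e', S₁ e' ⊆ S e' := by
    intro e'
    by_cases h : e' = e
    · subst h; simp [hS₁, Finset.erase_subset]
    · simp [hS₁, h]
  -- Edges to be kept lose nothing, so the replicas demanded by `hkeep` stay available in later
  -- steps.
  have hkept : ∀ y e', keep y e' → y ∈ S e' → y ∈ S₁ e' := by
    intro y e' hy hye
    by_cases h : e' = e
    · subst h
      simp only [hS₁, Function.update_self, Finset.mem_erase]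
      refine ⟨?_, hye⟩
      rintro rfl
      exact hke hy
    · simpa [hS₁, h] using hye
  have hlt : ∑ e', (S₁ e').card < m := by
    rw [← hm]
    refine Finset.sum_lt_sum (fun e' _ => Finset.card_le_card (hsub e')) ⟨e, Finset.mem_univ _, ?_⟩
    simpa [hS₁] using Finset.card_erase_lt_of_mem hxe
  obtain ⟨S', hS', hS'k⟩ := ih _ hlt S₁
    (fun y e' he' hk hy => hendo y e' he' hk (hsub _ hy))
    (fun y i j hij hk hy => hleaf y i j hij hk (hsub _ hy))
    (fun y i j k hij hk hy hik hkk => by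
      obtain ⟨l, h1, h2, h3, h4⟩ := hkeep y i j k hij hk (hsub _ hy) hik hkk
      exact ⟨l, h1, h2, h3, hkept _ _ h3 h4⟩) rfl
  exact ⟨S', .head ⟨e, he, x, hxe, hrem, rfl⟩ hS', fun e' he' y hy =>
    ⟨hsub _ (hS'k e' he' y hy).1, (hS'k e' he' y hy).2⟩⟩

end Thinning

end BinaryJointree

end CausalGraph

/-! ### Jointrees from rooted binary trees -/

/-- Rooted binary trees whose leaves are labeled. -/
inductive LabeledTree (V : Type*)
  | leaf (v : V)
  | node (l r : LabeledTree V)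

namespace LabeledTree

variable {V : Type*}

/-- The labels of the leaves, with multiplicities. -/
def leaves : LabeledTree V → Multiset V
  | leaf v => {v}
  | node l r => l.leaves + r.leaves

/-- One of the two children of a node. -/
def child (b : Bool) : LabeledTree V → Option (LabeledTree V)
  | leaf _ => none
  | node l r => some (if b then r else l)

/-- The subtree at an address; the last step of the address is its first entry. -/
def subtree (T : LabeledTree V) : List Bool → Option (LabeledTree V)
  | [] => some T
  | b :: p => (T.subtree p).bind (child b)

/-- The label of a leaf. -/
def label : LabeledTree V → Option V
  | leaf v => some v
  | node _ _ => none

theorem label_eq_some {T : LabeledTree V} {v : V} : T.label = some v ↔ T = leaf v := by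
  cases T <;> simp [label]

theorem subtree_append (T : LabeledTree V) (p q : List Bool) :
    T.subtree (p ++ q) = (T.subtree q).bind (fun s => s.subtree p) := by
  induction p with
  | nil => simp [subtree]
  | cons b p ih => simp [subtree, ih, Option.bind_assoc]

theorem leaves_subtree_le {T s : LabeledTree V} {p : List Bool} (h : T.subtree p = some s) :
    s.leaves ≤ T.leaves := by
  induction p generalizing s with
  | nil => simp [subtree] at h; simp [h]
  | cons b p ih =>
    obtain ⟨t, ht, hs⟩ := Option.bind_eq_some_iff.1 h
    refine le_trans ?_ (ih ht)
    cases t with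
    | leaf v => simp [child] at hs
    | node l r =>
      simp only [child, Option.some.injEq] at hs
      subst hs
      cases b
      · exact Multiset.le_add_right _ _
      · exact Multiset.le_add_left _ _

theorem exists_subtree_of_mem_leaves {T : LabeledTree V} {v : V} (h : v ∈ T.leaves) :
    ∃ p, T.subtree p = some (leaf v) := by
  induction T with
  | leaf w => exact ⟨[], by simpa [leaves, subtree, eq_comm] using h⟩
  | node l r ihl ihr =>
    rcases Multiset.mem_add.1 h with h | h
    · obtain ⟨p, hp⟩ := ihl h
      exact ⟨p ++ [false], by simp [subtree_append, subtree, child, hp]⟩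
    · obtain ⟨p, hp⟩ := ihr h
      exact ⟨p ++ [true], by simp [subtree_append, subtree, child, hp]⟩

theorem mem_leaves_of_subtree {T : LabeledTree V} {v : V} {p : List Bool}
    (h : T.subtree p = some (leaf v)) : v ∈ T.leaves :=
  Multiset.mem_of_le (leaves_subtree_le h) (by simp [leaves])

theorem subtree_leaf_eq_some {v : V} {p : List Bool} {s : LabeledTree V}
    (h : (leaf v).subtree p = some s) : p = [] := by
  induction p generalizing s with
  | nil => rfl
  | cons b p ih =>
    obtain ⟨t, ht, hs⟩ := Option.bind_eq_some_iff.1 h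
    obtain rfl := ih ht
    obtain rfl : leaf v = t := by simpa [subtree] using ht
    simp [child] at hs

theorem subtree_node_append {l r s : LabeledTree V} {p : List Bool} {b : Bool}
    (h : (node l r).subtree (p ++ [b]) = some s) : (if b then r else l).subtree p = some s := by
  simpa [subtree_append, subtree, child] using h

theorem subtree_leaf_unique [DecidableEq V] {T : LabeledTree V} {v : V} (hT : T.leaves.count v ≤ 1)
    {p q : List Bool} (hp : T.subtree p = some (leaf v)) (hq : T.subtree q = some (leaf v)) :
    p = q := by
  induction T generalizing p q with
  | leaf w => rw [subtree_leaf_eq_some hp, subtree_leaf_eq_some hq]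
  | node l r ihl ihr =>
    have hc : l.leaves.count v + r.leaves.count v ≤ 1 := by
      simpa [leaves, Multiset.count_add] using hT
    -- Addresses grow at the front, so the first step away from the root is the last entry.
    rcases List.eq_nil_or_concat p with rfl | ⟨p, b, rfl⟩
    · simp [subtree] at hp
    rcases List.eq_nil_or_concat q with rfl | ⟨q, c, rfl⟩
    · simp [subtree] at hq
    simp only [List.concat_eq_append] at hp hq ⊢
    have hp := subtree_node_append hp
    have hq := subtree_node_append hq
    have hp' := Multiset.one_le_count_iff_mem.2 (mem_leaves_of_subtree hp)
    have hq' := Multiset.one_le_count_iff_mem.2 (mem_leaves_of_subtree hq)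
    cases b <;> cases c <;> simp only [if_true, if_false, Bool.false_eq_true] at hp hq hp' hq'
    · rw [ihl (by omega) hp hq]
    · omega
    · omega
    · rw [ihr (by omega) hp hq]

theorem finite_subtree (T : LabeledTree V) : {p | (T.subtree p).isSome}.Finite := by
  induction T with
  | leaf v =>
    refine (Set.finite_singleton []).subset fun p hp => ?_
    obtain ⟨s, hs⟩ := Option.isSome_iff_exists.1 hp
    exact subtree_leaf_eq_some hs
  | node l r ihl ihr =>
    refine ((Set.finite_singleton []).union
      ((ihl.image (· ++ [false])).union (ihr.image (· ++ [true])))).subset fun p hp => ?_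
    obtain ⟨s, hs⟩ := Option.isSome_iff_exists.1 hp
    rcases List.eq_nil_or_concat p with rfl | ⟨p, b, rfl⟩
    · exact Or.inl rfl
    · rw [List.concat_eq_append] at hs ⊢
      have := subtree_node_append hs
      cases b
      · exact Or.inr (Or.inl ⟨p, Option.isSome_iff_exists.2 ⟨s, this⟩, rfl⟩)
      · exact Or.inr (Or.inr ⟨p, Option.isSome_iff_exists.2 ⟨s, this⟩, rfl⟩)

/-- The nodes of the unrooted tree in which the root of `node (leaf v) t` has been merged with its
child `leaf v`. -/
abbrev Addr (v : V) (t : LabeledTree V) : Type :=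
  {p : List Bool // ((node (leaf v) t).subtree p).isSome ∧ p ≠ [false]}

namespace Addr

variable {v : V} {t : LabeledTree V}

instance : Finite (Addr v t) :=
  ((finite_subtree (node (leaf v) t)).subset fun _ hp => hp.1).to_subtype

/-- The unrooted tree; two addresses are adjacent if one extends the other by one step. -/
def graph (v : V) (t : LabeledTree V) : SimpleGraph (Addr v t) where
  Adj p q := ∃ b, p.1 = b :: q.1 ∨ q.1 = b :: p.1
  symm := ⟨fun _ _ ⟨b, h⟩ => ⟨b, h.symm⟩⟩
  loopless := ⟨fun p ⟨b, h⟩ => by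
    rcases h with h | h <;> exact absurd (congrArg List.length h) (by simp)⟩

theorem exists_subtree (p : Addr v t) : ∃ s, (node (leaf v) t).subtree p.1 = some s :=
  Option.isSome_iff_exists.1 p.2.1

/-- The root. -/
def root (v : V) (t : LabeledTree V) : Addr v t := ⟨[], by simp [subtree], by simp⟩

theorem exists_parent (p : Addr v t) {b : Bool} {q : List Bool} (h : p.1 = b :: q) :
    ∃ p' : Addr v t, p'.1 = q ∧ (graph v t).Adj p p' := by
  obtain ⟨s, hs⟩ := p.exists_subtree
  rw [h] at hs
  obtain ⟨t', ht', hs'⟩ := Option.bind_eq_some_iff.1 hs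
  refine ⟨⟨q, by simp [ht'], ?_⟩, rfl, b, Or.inl h⟩
  rintro rfl
  obtain rfl : leaf v = t' := by simpa [subtree, child] using ht'
  simp [child] at hs'

/-- The condition `hb` is due to the merged root, whose left child is not a separate node. -/
theorem exists_child (p : Addr v t) {l r : LabeledTree V}
    (h : (node (leaf v) t).subtree p.1 = some (node l r)) (b : Bool) (hb : p.1 = [] → b = true) :
    ∃ p' : Addr v t, p'.1 = b :: p.1 ∧ (graph v t).Adj p p' := by
  refine ⟨⟨b :: p.1, by simp [subtree, h, child], ?_⟩, rfl, b, Or.inr rfl⟩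
  intro hp
  have : p.1 = [] := by simpa using congrArg List.tail hp
  simp [this, hb this] at hp

/-- Removing the edge above `p` separates the addresses below `p` from the others. -/
theorem suffix_iff_of_reachable {p q : Addr v t} {b : Bool} (hq : p.1 = b :: q.1)
    {i j : Addr v t} (h : ((graph v t).deleteEdges {s(p, q)}).Reachable i j) :
    p.1 <:+ i.1 ↔ p.1 <:+ j.1 := by
  obtain ⟨w⟩ := h
  induction w with
  | nil => rfl
  | @cons i k j hik _ ih =>
    rw [← ih]
    have key : ∀ {i k : Addr v t} {c : Bool}, k.1 = c :: i.1 → s(i, k) ≠ s(p, q) →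
        (p.1 <:+ i.1 ↔ p.1 <:+ k.1) := by
      intro i k c hk hne
      rw [hk, List.suffix_cons_iff]
      refine ⟨Or.inr, fun h => h.resolve_left fun h => hne ?_⟩
      obtain rfl : p = k := Subtype.ext (h.trans hk.symm)
      obtain rfl : i = q := Subtype.ext (by rw [hq] at hk; exact (List.cons.inj hk).2.symm)
      exact Sym2.eq_swap
    rw [SimpleGraph.deleteEdges_adj] at hik
    obtain ⟨⟨c, hc | hc⟩, hne⟩ := hik
    · exact (key hc (by rwa [Sym2.eq_swap])).symm
    · exact key hc hne

/-- Passing to parents leads every node to the root, and every edge is a bridge, since without it no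
walk leaves the set of addresses below its lower end. -/
theorem isTree_graph (v : V) (t : LabeledTree V) : (graph v t).IsTree := by
  have hroot : ∀ (q : List Bool) (p : Addr v t), p.1 = q → (graph v t).Reachable p (root v t) := by
    intro q
    induction q with
    | nil => intro p hp; rw [show p = root v t from Subtype.ext hp]
    | cons b q ih =>
      intro p hp
      obtain ⟨p', hp', hadj⟩ := p.exists_parent hp
      exact hadj.reachable.trans (ih p' hp')
  have : Nonempty (Addr v t) := ⟨root v t⟩
  refine ⟨⟨fun p q => (hroot _ p rfl).trans (hroot _ q rfl).symm⟩, ?_⟩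
  rw [SimpleGraph.isAcyclic_iff_forall_isBridge]
  have key : ∀ {p q : Addr v t} {b : Bool}, p.1 = b :: q.1 → (graph v t).IsBridge s(p, q) := by
    intro p q b h
    rw [SimpleGraph.isBridge_iff]
    intro hr
    have := (suffix_iff_of_reachable h hr).1 (List.suffix_refl _)
    have := this.length_le
    simp [h] at this
  intro e he
  induction e using Sym2.ind with
  | _ p q =>
  obtain ⟨b, h | h⟩ := he
  · exact key h
  · rw [Sym2.eq_swap]; exact key h

/-- The address in the rooted tree of the leaf, if any, at a node of the unrooted tree. -/
def rooted (p : Addr v t) : List Bool := if p.1 = [] then [false] else p.1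

theorem rooted_of_ne {p : Addr v t} (h : p.1 ≠ []) : p.rooted = p.1 := if_neg h

/-- The value `[false]` given to the root is not an address of any other node. -/
theorem rooted_injective : Function.Injective (rooted : Addr v t → List Bool) := by
  intro p q h
  apply Subtype.ext
  unfold rooted at h
  split_ifs at h with h1 h2 h2
  · rw [h1, h2]
  · exact absurd h.symm q.2.2
  · exact absurd h p.2.2
  · exact h

/-- The label of a leaf of the unrooted tree. -/
def host (p : Addr v t) : Option V := ((node (leaf v) t).subtree p.rooted).bind label

theorem host_eq_some {p : Addr v t} {w : V} :
    p.host = some w ↔ (node (leaf v) t).subtree p.rooted = some (leaf w) := by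
  simp only [host, Option.bind_eq_some_iff, label_eq_some]
  constructor
  · rintro ⟨s, hs, rfl⟩; exact hs
  · exact fun h => ⟨_, h, rfl⟩

theorem host_root {p : Addr v t} (h : p.1 = []) : p.host = some v := by
  rw [host_eq_some]
  simp [rooted, h, subtree, child]

theorem host_eq_none {p : Addr v t} (h : p.host = none) :
    p.1 ≠ [] ∧ ∃ l r, (node (leaf v) t).subtree p.1 = some (node l r) := by
  have hp : p.1 ≠ [] := fun hp => by simp [host_root hp] at h
  refine ⟨hp, ?_⟩
  obtain ⟨s, hs⟩ := p.exists_subtree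
  cases s with
  | leaf w =>
    rw [host_eq_some.2 (by rwa [rooted_of_ne hp])] at h
    simp at h
  | node l r => exact ⟨l, r, hs⟩

/-- A node that hosts a label has only one possible neighbor. -/
theorem adj_host {p q : Addr v t} {w : V} (h : p.host = some w) (hadj : (graph v t).Adj p q) :
    q.1 = if p.1 = [] then [true] else p.1.tail := by
  rw [host_eq_some] at h
  split_ifs with hp
  · obtain ⟨b, hb | hb⟩ := hadj
    · simp [hp] at hb
    · rw [hp] at hb
      cases b
      · exact absurd hb q.2.2
      · exact hb
  · rw [rooted_of_ne hp] at h
    obtain ⟨b, hb | hb⟩ := hadj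
    · simp [hb]
    · obtain ⟨s, hs⟩ := q.exists_subtree
      rw [hb] at hs
      simp [subtree, h, child] at hs

theorem exists_host {w : V} (h : w ∈ (node (leaf v) t).leaves) : ∃ p : Addr v t, p.host = some w := by
  obtain ⟨p, hp⟩ := exists_subtree_of_mem_leaves h
  by_cases hf : p = [false]
  · subst hf
    refine ⟨root v t, ?_⟩
    rw [host_root rfl]
    simpa [subtree, child] using hp
  · refine ⟨⟨p, by simp [hp], hf⟩, ?_⟩
    rw [host_eq_some, rooted_of_ne, hp]
    rintro rfl
    simp [subtree] at hp

theorem host_unique [DecidableEq V] {w : V} (h : (node (leaf v) t).leaves.count w ≤ 1)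
    {p q : Addr v t} (hp : p.host = some w) (hq : q.host = some w) : p = q :=
  rooted_injective (subtree_leaf_unique h (host_eq_some.1 hp) (host_eq_some.1 hq))

theorem ncard_neighborSet_host {p : Addr v t} {w : V} (h : p.host = some w) :
    ((graph v t).neighborSet p).ncard ≤ 1 := by
  rw [Set.ncard_le_one (Set.toFinite _)]
  intro a ha b hb
  exact Subtype.ext ((adj_host h ha).trans (adj_host h hb).symm)

theorem ncard_neighborSet_internal {p : Addr v t} (h : p.host = none) :
    ((graph v t).neighborSet p).ncard = 3 := by
  obtain ⟨hp, l, r, hs⟩ := host_eq_none h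
  obtain ⟨b, q, hq⟩ := List.exists_cons_of_ne_nil hp
  obtain ⟨a₁, h1, hadj1⟩ := p.exists_parent hq
  obtain ⟨a₂, h2, hadj2⟩ := p.exists_child hs false (fun h => absurd h hp)
  obtain ⟨a₃, h3, hadj3⟩ := p.exists_child hs true (fun h => absurd h hp)
  rw [Set.ncard_eq_three]
  refine ⟨a₁, a₂, a₃, ?_, ?_, ?_, ?_⟩
  · rintro rfl
    have := congrArg List.length (h1.symm.trans h2)
    simp [hq] at this
    omega
  · rintro rfl
    have := congrArg List.length (h1.symm.trans h3)
    simp [hq] at this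
    omega
  · rintro rfl
    simpa using h2.symm.trans h3
  · ext a
    simp only [SimpleGraph.mem_neighborSet, Set.mem_insert_iff, Set.mem_singleton_iff]
    constructor
    · rintro ⟨c, hc | hc⟩
      · exact Or.inl (Subtype.ext (by rw [h1]; rw [hq] at hc; exact (List.cons.inj hc).2.symm))
      · cases c
        · exact Or.inr (Or.inl (Subtype.ext (hc.trans h2.symm)))
        · exact Or.inr (Or.inr (Subtype.ext (hc.trans h3.symm)))
    · rintro (rfl | rfl | rfl) <;> assumption

end Addr

/-- The binary jointree obtained from a rooted binary tree whose left child is a leaf. -/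
def jointree [DecidableEq V] (G : CausalGraph V) (v : V) (t : LabeledTree V)
    (hmem : ∀ w, w ∈ (node (leaf v) t).leaves)
    (hexo : ∀ u ∈ G.exogenous, (node (leaf v) t).leaves.count u ≤ 1) :
    CausalGraph.BinaryJointree G (Addr v t) where
  tree := Addr.graph v t
  isTree := Addr.isTree_graph v t
  host := Addr.host
  leaf_degree _ _ h := Addr.ncard_neighborSet_host h
  internal_degree _ h := Addr.ncard_neighborSet_internal h
  exists_host w := Addr.exists_host (hmem w)
  exogenous_unique _ hu _ _ hi hj := Addr.host_unique (hexo _ hu) hi hj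

/-! ### Separators of the jointree of a rooted tree -/

section Separators

variable [DecidableEq V] {G : CausalGraph V} {v : V} {t : LabeledTree V}

/-- The variables mentioned in a tree. -/
def vars (G : CausalGraph V) : LabeledTree V → Finset V
  | leaf v => G.factorVars v
  | node l r => vars G l ∪ vars G r

theorem factorVars_subset_vars {s : LabeledTree V} {w : V} (h : w ∈ s.leaves) :
    G.factorVars w ⊆ s.vars G := by
  induction s with
  | leaf u => rw [Multiset.mem_singleton.1 h, vars]
  | node l r ihl ihr =>
    rcases Multiset.mem_add.1 h with h | h
    · exact (ihl h).trans Finset.subset_union_left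
    · exact (ihr h).trans Finset.subset_union_right

theorem factorVars_subset_vars_of_suffix {p i : Addr v t} {s : LabeledTree V} {w : V}
    (hp : p.1 ≠ []) (hs : (node (leaf v) t).subtree p.1 = some s) (hi : i.host = some w)
    (h : p.1 <:+ i.1) : G.factorVars w ⊆ s.vars G := by
  obtain ⟨q, hq⟩ := h
  have hi0 : i.1 ≠ [] := by
    intro h0
    rw [h0, List.append_eq_nil_iff] at hq
    exact hp hq.2
  rw [Addr.host_eq_some, Addr.rooted_of_ne hi0, ← hq, subtree_append, hs] at hi
  exact factorVars_subset_vars (mem_leaves_of_subtree hi)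

variable [Fintype V] {hmem : ∀ w, w ∈ (node (leaf v) t).leaves}
  {hexo : ∀ u ∈ G.exogenous, (node (leaf v) t).leaves.count u ≤ 1}

/-- A variable in the separator of the edge above `p` is mentioned below `p` and elsewhere. -/
theorem exists_of_mem_sep {p q : Addr v t} {b : Bool} (hq : p.1 = b :: q.1) {x : V}
    (hx : x ∈ (jointree G v t hmem hexo).sep s(p, q)) :
    ∃ (i j : Addr v t) (w w' : V), i.host = some w ∧ j.host = some w' ∧ x ∈ G.factorVars w ∧
      x ∈ G.factorVars w' ∧ p.1 <:+ i.1 ∧ ¬ p.1 <:+ j.1 := by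
  have key : (jointree G v t hmem hexo).OnSide p q x ∧ (jointree G v t hmem hexo).OnSide q p x := by
    obtain ⟨i, j, he, hi, hj⟩ := by simpa only [CausalGraph.BinaryJointree.sep, Finset.mem_filter, Finset.mem_univ, true_and] using hx
    rcases Sym2.eq_iff.1 he with ⟨rfl, rfl⟩ | ⟨rfl, rfl⟩
    · exact ⟨hi, hj⟩
    · exact ⟨hj, hi⟩
  obtain ⟨⟨i, w, hi, hw, hxw⟩, ⟨j, w', hj, hw', hxw'⟩⟩ := key
  refine ⟨i, j, w, w', hw, hw', hxw, hxw',
    (Addr.suffix_iff_of_reachable hq hi).1 (List.suffix_refl _), fun h => ?_⟩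
  rw [Sym2.eq_swap] at hj
  have := ((Addr.suffix_iff_of_reachable hq hj).2 h).length_le
  simp [hq] at this

end Separators

end LabeledTree

namespace LabeledTree

/-! ### Clusters of unthinned jointrees and elimination orders -/

section Majority

variable {V : Type*} [DecidableEq V]

/-- The elements of at least two of three sets. -/
def majority (A B C : Finset V) : Finset V := A ∩ B ∪ A ∩ C ∪ B ∩ C

theorem mem_majority {A B C : Finset V} {x : V} :
    x ∈ majority A B C ↔ x ∈ A ∧ x ∈ B ∨ x ∈ A ∧ x ∈ C ∨ x ∈ B ∧ x ∈ C := by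
  simp [majority]

/-- The clusters of all internal nodes of the tree have at most `k` elements if the factors outside
the tree mention the variables in `O`. -/
def ClusterBound (G : CausalGraph V) (k : ℕ) : LabeledTree V → Finset V → Prop
  | leaf _, _ => True
  | node l r, O => (majority (l.vars G) (r.vars G) O).card ≤ k ∧
      ClusterBound G k l (r.vars G ∪ O) ∧ ClusterBound G k r (l.vars G ∪ O)

variable {G : CausalGraph V} {k : ℕ}

/-- Each step down adds the variables of the sibling subtree to the outside set, as in the recursion
of `ClusterBound`; a leaf outside the smaller subtree was either outside before or lies in that
sibling. -/
theorem exists_outside {T : LabeledTree V} (hT : T.ClusterBound G k ∅) (p : List Bool)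
    (s : LabeledTree V) (hs : T.subtree p = some s) :
    ∃ O, s.ClusterBound G k O ∧
      ∀ q w, T.subtree q = some (leaf w) → ¬ p <:+ q → G.factorVars w ⊆ O := by
  induction p generalizing s with
  | nil =>
    obtain rfl : T = s := by simpa [subtree] using hs
    exact ⟨∅, hT, fun q w _ h => absurd (List.nil_suffix) h⟩
  | cons b p ih =>
    obtain ⟨t, ht, hts⟩ := Option.bind_eq_some_iff.1 hs
    obtain ⟨O, hO, hout⟩ := ih t ht
    cases t with
    | leaf w => simp [child] at hts
    | node l r =>
      obtain ⟨-, hl, hr⟩ := hO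
      have key : ∀ q w, T.subtree q = some (leaf w) → ¬ (b :: p) <:+ q →
          G.factorVars w ⊆ (if b then l else r).vars G ∪ O := by
        intro q w hq hnot
        by_cases hpq : p <:+ q
        · obtain ⟨q', rfl⟩ := hpq
          rcases List.eq_nil_or_concat q' with rfl | ⟨q', c, rfl⟩
          · simp [ht] at hq
          · rw [List.concat_eq_append] at hq hnot
            rw [subtree_append, ht] at hq
            have hq := subtree_node_append hq
            have hcb : c ≠ b := by
              rintro rfl
              exact hnot ⟨q', by simp⟩
            refine (factorVars_subset_vars (mem_leaves_of_subtree hq)).trans ?_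
            cases b <;> cases c <;> simp at hcb ⊢
        · exact (hout q w hq hpq).trans Finset.subset_union_right
      simp only [child, Option.some.injEq] at hts
      subst hts
      refine ⟨_, ?_, key⟩
      cases b
      · exact hl
      · exact hr

/-- A variable in the separator of an edge at an internal node is mentioned on both sides of it,
hence in two of the three branches: the two child subtrees and the outside. -/
theorem width_jointree_le [Fintype V] {v : V} {t : LabeledTree V}
    {hmem : ∀ w, w ∈ (node (leaf v) t).leaves}
    {hexo : ∀ u ∈ G.exogenous, (node (leaf v) t).leaves.count u ≤ 1}
    [Fintype (Addr v t)] (hk : ∀ w, (G.factorVars w).card ≤ k)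
    (hT : (node (leaf v) t).ClusterBound G k ∅) :
    (jointree G v t hmem hexo).width (jointree G v t hmem hexo).sep ≤ k - 1 := by
  refine Nat.sub_le_sub_right (Finset.sup_le fun p _ => ?_) 1
  rw [CausalGraph.BinaryJointree.cluster]
  split
  · exact hk _
  rename_i hp
  have hp : p.host = none := hp
  obtain ⟨hp0, l, r, hs⟩ := Addr.host_eq_none hp
  obtain ⟨O, ⟨hO, -, -⟩, hout⟩ := exists_outside hT p.1 _ hs
  refine (Finset.card_le_card fun x hx => ?_).trans hO
  simp only [Finset.mem_filter, Finset.mem_univ, true_and] at hx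
  obtain ⟨q, hpq, hx⟩ := hx
  have hleaf : ∀ (i : Addr v t) w, i.host = some w → x ∈ G.factorVars w → ¬ p.1 <:+ i.1 → x ∈ O :=
    fun i w hi hxw hpi => by
      by_cases hi0 : i.1 = []
      · rw [Addr.host_root hi0] at hi
        obtain rfl := Option.some.inj hi
        -- The leaf merged into the root sits at `[false]` in the rooted tree.
        refine hout [false] v (by simp [subtree, child]) ?_ hxw
        intro h
        rcases List.suffix_cons_iff.1 h with h | h
        · exact p.2.2 h
        · exact hp0 (List.suffix_nil.1 h)
      · rw [Addr.host_eq_some, Addr.rooted_of_ne hi0] at hi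
        exact hout _ _ hi hpi hxw
  have hchild : ∀ (i c : Addr v t) (b : Bool) w, c.1 = b :: p.1 → i.host = some w →
      x ∈ G.factorVars w → c.1 <:+ i.1 → x ∈ (if b then r else l).vars G := by
    intro i c b w hc hi hxw hci
    refine factorVars_subset_vars_of_suffix (by simp [hc]) ?_ hi hci hxw
    simp [hc, subtree, hs, child]
  have hbelow : ∀ (i : Addr v t) w, i.host = some w → x ∈ G.factorVars w → p.1 <:+ i.1 →
      ∃ b, (b :: p.1) <:+ i.1 ∧ x ∈ (if b then r else l).vars G := by
    intro i w hi hxw hpi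
    have hsuf := hpi
    obtain ⟨q', hq'⟩ := hpi
    rcases List.eq_nil_or_concat q' with rfl | ⟨q', b, rfl⟩
    · obtain rfl : p = i := Subtype.ext hq'
      rw [hp] at hi
      simp at hi
    · have hbi : (b :: p.1) <:+ i.1 := ⟨q', by rw [← hq']; simp⟩
      obtain ⟨c, hc, -⟩ := p.exists_child hs b (fun h => absurd h hp0)
      exact ⟨b, hbi, hchild i c b w hc hi hxw (by rwa [hc])⟩
  rw [mem_majority]
  obtain ⟨b, hb | hb⟩ := hpq
  · obtain ⟨i, j, w, w', hi, hj, hxw, hxw', hpi, hpj⟩ := exists_of_mem_sep hb hx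
    have h1 := hleaf j w' hj hxw' hpj
    obtain ⟨c, -, h2⟩ := hbelow i w hi hxw hpi
    cases c
    · exact Or.inr (Or.inl ⟨h2, h1⟩)
    · exact Or.inr (Or.inr ⟨h2, h1⟩)
  · rw [Sym2.eq_swap] at hx
    obtain ⟨i, j, w, w', hi, hj, hxw, hxw', hpi, hpj⟩ := exists_of_mem_sep hb hx
    have h1 := hchild i q b w hb hi hxw hpi
    by_cases h : p.1 <:+ j.1
    · obtain ⟨c, hc, h2⟩ := hbelow j w' hj hxw' h
      have hcb : c ≠ b := by
        rintro rfl
        exact hpj (by rwa [hb])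
      cases b <;> cases c <;> simp at hcb h1 h2 ⊢ <;> tauto
    · have h2 := hleaf j w' hj hxw' h
      cases b
      · exact Or.inr (Or.inl ⟨h1, h2⟩)
      · exact Or.inr (Or.inr ⟨h1, h2⟩)

/-- A tree can be rotated until its left child is a leaf. -/
theorem exists_rotation (l r : LabeledTree V) (h : (node l r).ClusterBound G k ∅) :
    ∃ v t, (node (leaf v) t).ClusterBound G k ∅ ∧
      (node (leaf v) t).leaves = (node l r).leaves := by
  induction l generalizing r with
  | leaf v => exact ⟨v, r, h, rfl⟩
  | node a b iha _ =>
    obtain ⟨-, ⟨h1, h2, h3⟩, h4⟩ := h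
    -- The rotation to `node a (node b r)` leaves the branches `a`, `b`, `r` at the real internal
    -- node unchanged. The root only subdivides an edge, and its cluster is contained in the cluster
    -- of that node.
    obtain ⟨v, t, ht, hl⟩ := iha (node b r) (by
      refine ⟨(Finset.card_le_card fun x hx => ?_).trans h1, ?_,
        (Finset.card_le_card fun x hx => ?_).trans h1, ?_, ?_⟩
      · simp only [mem_majority, vars, Finset.mem_union, Finset.notMem_empty] at hx ⊢
        tauto
      · convert h2 using 1
        simp only [vars, Finset.union_empty]
      · simp only [mem_majority, Finset.mem_union, Finset.notMem_empty] at hx ⊢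
        tauto
      · convert h3 using 1
        ext x; simp only [Finset.union_empty, Finset.mem_union]; tauto
      · convert h4 using 1
        ext x; simp only [vars, Finset.union_empty, Finset.mem_union]; tauto)
    refine ⟨v, t, ht, hl.trans ?_⟩
    simp only [leaves]
    rw [add_assoc]

theorem causalTreewidth_le_width [Fintype V] {N : Type} [Fintype N] [DecidableEq N]
    {T : CausalGraph.BinaryJointree G N} {S : Sym2 N → Finset V} (hS : T.IsThinned S) :
    G.causalTreewidth ≤ (T.width S : ℕ∞) :=
  sInf_le (s := {w | ∃ (N : Type) (_ : Fintype N) (_ : DecidableEq N)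
    (T : CausalGraph.BinaryJointree G N) (S : Sym2 N → Finset V),
      T.IsThinned S ∧ w = (T.width S : ℕ∞)}) ⟨N, _, _, T, S, hS, rfl⟩

/-- Each factor occurs once and no separator is thinned. A single leaf gives the one-node jointree;
any other tree is first rotated so that its root can be merged with a leaf. -/
theorem causalTreewidth_le_of_clusterBound [Fintype V] (T : LabeledTree V)
    (hT : T.ClusterBound G k ∅) (hleaves : T.leaves = Finset.univ.val)
    (hk : ∀ w, (G.factorVars w).card ≤ k) : G.causalTreewidth ≤ (k - 1 : ℕ) := by
  cases T with
  | leaf v =>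
    have huniv : ∀ w, w = v := fun w => by
      have : w ∈ (leaf v).leaves := by rw [hleaves]; simp
      exact Multiset.mem_singleton.1 this
    let T : CausalGraph.BinaryJointree G Unit :=
      { tree := ⊥
        isTree := .of_subsingleton
        host := fun _ => some v
        leaf_degree := by simp [SimpleGraph.neighborSet]
        internal_degree := by simp
        exists_host := fun w => ⟨(), by rw [huniv w]⟩
        exogenous_unique := fun _ _ _ _ _ _ => rfl }
    refine (causalTreewidth_le_width .refl (T := T)).trans ?_
    refine Nat.cast_le.2 (Nat.sub_le_sub_right (Finset.sup_le fun i _ => ?_) 1)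
    exact hk v
  | node l r =>
    obtain ⟨v, t, ht, hl⟩ := exists_rotation l r hT
    rw [hleaves] at hl
    have hmem : ∀ w, w ∈ (node (leaf v) t).leaves := fun w => by rw [hl]; simp
    have hexo : ∀ u ∈ G.exogenous, (node (leaf v) t).leaves.count u ≤ 1 := fun u _ => by
      rw [hl]
      exact Multiset.nodup_iff_count_le_one.1 Finset.univ.nodup u
    let _ : Fintype (Addr v t) := Fintype.ofFinite _
    let J := jointree G v t hmem hexo
    refine (causalTreewidth_le_width .refl (T := J)).trans ?_
    exact Nat.cast_le.2 (width_jointree_le hk ht)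

end Majority

/-! ### From an elimination order to a tree -/

section Merging

variable {V : Type*} [DecidableEq V] {G : CausalGraph V} {k : ℕ}

/-- The variables mentioned in a forest. -/
def forestVars (G : CausalGraph V) (M : Multiset (LabeledTree V)) : Finset V :=
  (M.map (vars G)).sup

/-- In each tree of the forest the clusters of internal nodes have at most `k` elements, and all
variables that occur in two trees belong to `R`. -/
def ForestBound (G : CausalGraph V) (k : ℕ) (R : Finset V) (M : Multiset (LabeledTree V)) : Prop :=
  ∀ T M', M = T ::ₘ M' →
    T.ClusterBound G k (forestVars G M') ∧ T.vars G ∩ forestVars G M' ⊆ R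

theorem forestVars_cons (T : LabeledTree V) (M : Multiset (LabeledTree V)) :
    forestVars G (T ::ₘ M) = T.vars G ∪ forestVars G M := by
  simp [forestVars]

theorem mem_forestVars {M : Multiset (LabeledTree V)} {x : V} :
    x ∈ forestVars G M ↔ ∃ T ∈ M, x ∈ T.vars G := by
  induction M using Multiset.induction with
  | empty => simp [forestVars]
  | cons T M ih => simp [forestVars_cons, ih]

/-- A variable in two of the branches `T₁`, `T₂` and the rest is shared between trees, hence in `R`,
and it occurs in `T₁` or `T₂`. This bounds the new cluster; the other clusters see the same outside
variables as before. -/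
theorem ForestBound.merge {R : Finset V} {T₁ T₂ : LabeledTree V} {M : Multiset (LabeledTree V)}
    (h : ForestBound G k R (T₁ ::ₘ T₂ ::ₘ M))
    (hk : ((T₁.vars G ∪ T₂.vars G) ∩ R).card ≤ k) : ForestBound G k R (node T₁ T₂ ::ₘ M) := by
  intro T M' hM
  rcases Multiset.cons_eq_cons.1 hM with ⟨rfl, rfl⟩ | ⟨-, M'', rfl, rfl⟩
  · obtain ⟨h1, h1'⟩ := h T₁ _ rfl
    obtain ⟨h2, h2'⟩ := h T₂ _ (Multiset.cons_swap _ _ _)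
    rw [forestVars_cons] at h1 h1' h2 h2'
    refine ⟨⟨(Finset.card_le_card fun x hx => ?_).trans hk, h1, h2⟩, fun x hx => ?_⟩
    · have a1 := @h1' x
      have a2 := @h2' x
      simp only [mem_majority, Finset.mem_inter, Finset.mem_union] at hx a1 a2 ⊢
      tauto
    · have a1 := @h1' x
      have a2 := @h2' x
      simp only [vars, Finset.mem_inter, Finset.mem_union] at hx a1 a2
      tauto
  · obtain ⟨h1, h2⟩ := h T (T₁ ::ₘ T₂ ::ₘ M'') (by
      rw [Multiset.cons_swap T₂, Multiset.cons_swap T₁])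
    have : forestVars G (T₁ ::ₘ T₂ ::ₘ M'') = forestVars G (node T₁ T₂ ::ₘ M'') := by
      simp only [forestVars_cons, vars, Finset.union_assoc]
    rw [this] at h1 h2
    exact ⟨h1, h2⟩

/-- All trees of a forest that have a property can be merged if their common part is small. -/
theorem exists_merge_all {R P : Finset V} (p : LabeledTree V → Prop)
    (hp : ∀ T₁ T₂, p T₁ → p T₂ → p (node T₁ T₂)) (hP : P.card ≤ k)
    (M : Multiset (LabeledTree V)) (hM : ForestBound G k R M)
    (hcov : ∀ T ∈ M, p T → T.vars G ∩ R ⊆ P) :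
    ∃ M', ForestBound G k R M' ∧ (M'.map leaves).sum = (M.map leaves).sum ∧
      (∀ T ∈ M', (p T ∧ T.vars G ∩ R ⊆ P) ∨ (T ∈ M ∧ ¬ p T)) ∧
      ∀ T₁ T₂ M'', M' = T₁ ::ₘ T₂ ::ₘ M'' → ¬ (p T₁ ∧ p T₂) := by
  induction hn : Multiset.card M using Nat.strong_induction_on generalizing M with
  | _ n ih =>
  by_cases hex : ∃ T₁ T₂ M₀, M = T₁ ::ₘ T₂ ::ₘ M₀ ∧ p T₁ ∧ p T₂
  · obtain ⟨T₁, T₂, M₀, rfl, h1, h2⟩ := hex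
    have c1 := hcov T₁ (by simp) h1
    have c2 := hcov T₂ (by simp) h2
    have c : (T₁.vars G ∪ T₂.vars G) ∩ R ⊆ P := by
      rw [Finset.union_inter_distrib_right]
      exact Finset.union_subset c1 c2
    obtain ⟨M', hb, hl, hc, hu⟩ := ih (Multiset.card (node T₁ T₂ ::ₘ M₀))
      (by rw [← hn]; simp) (node T₁ T₂ ::ₘ M₀)
      (hM.merge ((Finset.card_le_card c).trans hP)) (by
        intro T hT hpT
        rcases Multiset.mem_cons.1 hT with rfl | hT
        · exact c
        · exact hcov T (by simp [hT]) hpT) rfl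
    refine ⟨M', hb, ?_, ?_, hu⟩
    · rw [hl]
      simp [leaves, add_assoc]
    · intro T hT
      refine (hc T hT).imp_right fun ⟨hTM, hpT⟩ => ⟨?_, hpT⟩
      rcases Multiset.mem_cons.1 hTM with rfl | hTM
      · exact absurd (hp _ _ h1 h2) hpT
      · simp [hTM]
  · refine ⟨M, hM, rfl, fun T hT => ?_, fun T₁ T₂ M'' h hpp => hex ⟨T₁, T₂, M'', h, hpp⟩⟩
    by_cases hpT : p T
    · exact Or.inl ⟨hpT, hcov T hT hpT⟩
    · exact Or.inr ⟨hT, hpT⟩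

/-- An elimination order turns a forest into a single tree. -/
theorem exists_tree_of_order (l : List V) (hl : l.Nodup) (F : Finset (Finset V))
    (hk : CausalGraph.elimSize l F ≤ k) (M : Multiset (LabeledTree V)) (hM0 : M ≠ 0)
    (hM : ForestBound G k l.toFinset M)
    (hF : ∀ T ∈ M, ∃ s ∈ F, T.vars G ∩ l.toFinset ⊆ s) :
    ∃ T : LabeledTree V, T.ClusterBound G k ∅ ∧ T.leaves = (M.map leaves).sum := by
  have hne : ∀ M' : Multiset (LabeledTree V), (M'.map leaves).sum = (M.map leaves).sum →
      M' ≠ 0 := by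
    rintro _ h rfl
    obtain ⟨T, hT⟩ := Multiset.exists_mem_of_ne_zero hM0
    have h0 : T.leaves = 0 := by
      rw [← nonpos_iff_eq_zero]
      exact (Multiset.le_sum_of_mem (Multiset.mem_map_of_mem _ hT)).trans (by rw [← h]; simp)
    have : ∀ T : LabeledTree V, T.leaves ≠ 0 := by
      intro T
      induction T with
      | leaf v => simp [leaves]
      | node l r ihl _ => simp [leaves, ihl]
    exact this T h0
  induction l generalizing F M with
  | nil =>
    -- Once all variables are eliminated, the remaining trees share none and can be glued with empty
    -- clusters.
    obtain ⟨M', hb, hs, -, hu⟩ := exists_merge_all (P := ∅) (fun _ => True) (fun _ _ _ _ => trivial)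
      (by simp) M hM (by simp)
    obtain ⟨T, hT⟩ := Multiset.exists_mem_of_ne_zero (hne M' hs)
    obtain ⟨M'', rfl⟩ := Multiset.exists_cons_of_mem hT
    have h0 : M'' = 0 := by
      by_contra h
      obtain ⟨T', hT'⟩ := Multiset.exists_mem_of_ne_zero h
      obtain ⟨M₃, rfl⟩ := Multiset.exists_cons_of_mem hT'
      exact hu _ _ _ rfl ⟨trivial, trivial⟩
    subst h0
    exact ⟨T, (hb T 0 rfl).1, by simpa using hs⟩
  | cons x l ih =>
    rw [CausalGraph.elimSize] at hk
    obtain ⟨hxl, hl⟩ := List.nodup_cons.1 hl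
    have hR : (x :: l).toFinset = insert x l.toFinset := List.toFinset_cons
    set P := (F.filter (fun s => x ∈ s)).sup id with hPdef
    have hsubP : ∀ s ∈ F, x ∈ s → s ⊆ P := fun s hs hx =>
      Finset.le_sup (f := id) (Finset.mem_filter.2 ⟨hs, hx⟩)
    obtain ⟨M', hb, hs, hc, hu⟩ := exists_merge_all (P := P) (fun T => x ∈ T.vars G)
      (fun _ _ h _ => Finset.mem_union_left _ h) ((le_max_left _ _).trans hk) M hM (by
        intro T hT hx
        obtain ⟨s, hs, hTs⟩ := hF T hT
        refine hTs.trans (hsubP s hs (hTs ?_))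
        simp [hx])
    -- After the merging at most one tree mentions `x`, so `x` can leave the set of possibly shared
    -- variables.
    have hb' : ForestBound G k l.toFinset M' := by
      intro T M'' hM''
      refine ⟨(hb T M'' hM'').1, fun y hy => ?_⟩
      have := (hb T M'' hM'').2 hy
      rw [hR] at this
      refine Finset.mem_of_mem_insert_of_ne this ?_
      rintro rfl
      obtain ⟨hyT, hyM⟩ := Finset.mem_inter.1 hy
      obtain ⟨T', hT', hyT'⟩ := mem_forestVars.1 hyM
      obtain ⟨M₃, rfl⟩ := Multiset.exists_cons_of_mem hT'
      exact hu _ _ _ hM'' ⟨hyT, hyT'⟩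
    have hF' : ∀ T ∈ M', ∃ s ∈ insert (P.erase x) (F.filter (fun s => x ∉ s)),
        T.vars G ∩ l.toFinset ⊆ s := by
      intro T hT
      rcases hc T hT with ⟨hxT, hTP⟩ | ⟨hTM, hxT⟩
      · refine ⟨_, Finset.mem_insert_self _ _, fun y hy => ?_⟩
        obtain ⟨hyT, hyl⟩ := Finset.mem_inter.1 hy
        refine Finset.mem_erase.2 ⟨?_, hTP (Finset.mem_inter.2 ⟨hyT, ?_⟩)⟩
        · rintro rfl
          exact hxl (List.mem_toFinset.1 hyl)
        · rw [hR]
          exact Finset.mem_insert_of_mem hyl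
      · obtain ⟨s, hs, hTs⟩ := hF T hTM
        have hTs' : T.vars G ∩ l.toFinset ⊆ s :=
          (Finset.inter_subset_inter_left (by rw [hR]; exact Finset.subset_insert _ _)).trans hTs
        -- The factor containing the tree may mention `x` although the tree does not; that factor is
        -- then absorbed into the product, and erasing `x` does no harm.
        by_cases hxs : x ∈ s
        · refine ⟨_, Finset.mem_insert_self _ _, fun y hy => ?_⟩
          refine Finset.mem_erase.2 ⟨?_, hsubP s hs hxs (hTs' hy)⟩
          rintro rfl
          exact hxT (Finset.mem_inter.1 hy).1
        · exact ⟨s, Finset.mem_insert_of_mem (Finset.mem_filter.2 ⟨hs, hxs⟩), hTs'⟩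
    obtain ⟨T, hT, hTl⟩ := ih hl _ ((le_max_right _ _).trans hk) M' (hne M' hs) hb' hF'
      (fun M'' h => hne M'' (h.trans hs))
    exact ⟨T, hT, hTl.trans hs⟩

end Merging

end LabeledTree

/-! ### Causal treewidth is at most treewidth -/

namespace CausalGraph

theorem causalTreewidth_le_treewidth {V : Type*} [Fintype V] [DecidableEq V] [Nonempty V]
    (G : CausalGraph V) : G.causalTreewidth ≤ G.treewidth := by
  refine le_iInf fun ⟨l, hl, hmem⟩ => ?_
  have huniv : l.toFinset = Finset.univ := by ext v; simp [hmem]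
  obtain ⟨T, hT, hTl⟩ := LabeledTree.exists_tree_of_order (G := G) l hl
    (Finset.univ.image G.factorVars) le_rfl (Finset.univ.val.map LabeledTree.leaf)
    (by simp [Finset.univ_eq_empty_iff]) (by
      intro T M' h
      have : T ∈ Finset.univ.val.map LabeledTree.leaf := by rw [h]; simp
      obtain ⟨v, -, rfl⟩ := Multiset.mem_map.1 this
      exact ⟨trivial, by simp [huniv]⟩) (by
      intro T hT
      obtain ⟨v, -, rfl⟩ := Multiset.mem_map.1 hT
      exact ⟨_, Finset.mem_image_of_mem _ (Finset.mem_univ v), Finset.inter_subset_left⟩)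
  refine LabeledTree.causalTreewidth_le_of_clusterBound T hT (hTl.trans ?_) fun w => ?_
  · simp [LabeledTree.leaves]
  · exact card_le_elimSize l _ _ (Finset.mem_image_of_mem _ (Finset.mem_univ w))
      ⟨w, Finset.mem_insert_self _ _, hmem w⟩

end CausalGraph

/-! ### Causal treewidth of `G_n` -/

section GridJointree

open CausalGraph GridVar LabeledTree

variable {n : ℕ}

/-- The subtree with the factor of `Z i j` and a replica of the mechanism of `X i`. -/
def innerBlock (i j : Fin n) : LabeledTree (GridVar n) := node (leaf (X i)) (leaf (Z i j))

/-- The subtree with the factor of `Z i j` and replicas of the mechanisms of `X i` and `Y j`. -/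
def block (i j : Fin n) : LabeledTree (GridVar n) := node (leaf (Y j)) (innerBlock i j)

/-- A caterpillar of blocks that ends in the factor of `U_Y`. -/
def spine : List (Fin n × Fin n) → LabeledTree (GridVar n)
  | [] => leaf UY
  | (i, j) :: L => node (block i j) (spine L)

/-- The jointree of the grid without the leaf of `U_X`. -/
noncomputable def gridTree (n : ℕ) : LabeledTree (GridVar n) :=
  spine (Finset.univ : Finset (Fin n × Fin n)).toList

theorem count_spine_UX (L : List (Fin n × Fin n)) : (spine L).leaves.count UX = 0 := by
  induction L with
  | nil => simp [spine, leaves]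
  | cons a L ih => simpa [spine, block, innerBlock, leaves] using ih

theorem count_spine_UY (L : List (Fin n × Fin n)) : (spine L).leaves.count UY = 1 := by
  induction L with
  | nil => simp [spine, leaves]
  | cons a L ih => simp [spine, block, innerBlock, leaves, ih]

theorem count_spine_Z (i j : Fin n) (L : List (Fin n × Fin n)) :
    (spine L).leaves.count (Z i j) = L.count (i, j) := by
  induction L with
  | nil => simp [spine, leaves]
  | cons a L ih =>
    obtain ⟨i', j'⟩ := a
    simp only [spine, block, innerBlock, leaves, Multiset.count_add, ih, List.count_cons,
      Multiset.count_singleton, beq_iff_eq, Prod.mk.injEq, reduceCtorEq, if_false, zero_add,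
      Z.injEq, eq_comm (a := i), eq_comm (a := j), add_comm]

theorem mem_spine {i j : Fin n} {L : List (Fin n × Fin n)} (h : (i, j) ∈ L) :
    X i ∈ (spine L).leaves ∧ Y j ∈ (spine L).leaves ∧ Z i j ∈ (spine L).leaves := by
  induction L with
  | nil => simp at h
  | cons a L ih =>
    rcases List.mem_cons.1 h with rfl | h
    · simp [spine, block, innerBlock, leaves]
    · have := ih h
      simp [spine, leaves, this]

theorem mem_leaves_gridTree (v : GridVar n) : v ∈ (node (leaf UX) (gridTree n)).leaves := by
  have h : ∀ i j : Fin n, (i, j) ∈ (Finset.univ : Finset (Fin n × Fin n)).toList := by simp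
  simp only [leaves, Multiset.mem_add, Multiset.mem_singleton]
  cases v with
  | UX => exact Or.inl rfl
  | UY => exact Or.inr (Multiset.one_le_count_iff_mem.1 (count_spine_UY _).ge)
  | X i => exact Or.inr (mem_spine (h i i)).1
  | Y j => exact Or.inr (mem_spine (h j j)).2.1
  | Z i j => exact Or.inr (mem_spine (h i j)).2.2

theorem count_leaves_gridTree_exogenous (u : GridVar n) (hu : u ∈ (gridGraph n).exogenous) :
    (node (leaf UX) (gridTree n)).leaves.count u ≤ 1 := by
  simp only [gridGraph, Finset.mem_insert, Finset.mem_singleton] at hu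
  rcases hu with rfl | rfl
  · simp [leaves, gridTree, count_spine_UX]
  · simp [leaves, gridTree, count_spine_UY]

theorem count_leaves_gridTree_Z (i j : Fin n) :
    (node (leaf UX) (gridTree n)).leaves.count (Z i j) ≤ 1 := by
  simp only [leaves, gridTree, Multiset.count_add, count_spine_Z, Multiset.count_singleton]
  simpa using List.nodup_iff_count_le_one.1 (Finset.nodup_toList _) (i, j)

/-- The jointree of the grid. -/
noncomputable def gridJointree (n : ℕ) :
    BinaryJointree (gridGraph n) (Addr (UX : GridVar n) (gridTree n)) :=
  jointree _ _ _ mem_leaves_gridTree count_leaves_gridTree_exogenous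

/-- The subtrees at the nodes along the caterpillar. -/
def IsSpine (s : LabeledTree (GridVar n)) : Prop :=
  s = node (leaf UX) (gridTree n) ∨ ∃ L, s = spine L

/-- The subtrees at the two endpoints of an edge. -/
def EdgeShape (s s' : LabeledTree (GridVar n)) : Prop :=
  (IsSpine s' ∧ ((∃ L, s = spine L) ∨ ∃ i j, s = block i j)) ∨
  (∃ i j, s' = block i j ∧ (s = leaf (Y j) ∨ s = innerBlock i j)) ∨
  (∃ i j, s' = innerBlock i j ∧ (s = leaf (X i) ∨ s = leaf (Z i j)))

theorem edgeShape_of_subtree (q : List Bool) (b : Bool) (hne : b :: q ≠ [false])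
    (s s' : LabeledTree (GridVar n))
    (hs : (node (leaf UX) (gridTree n)).subtree (b :: q) = some s)
    (hs' : (node (leaf UX) (gridTree n)).subtree q = some s') : EdgeShape s s' := by
  induction q generalizing b s s' with
  | nil =>
    obtain rfl : b = true := by cases b <;> simp at hne ⊢
    refine Or.inl ⟨Or.inl ?_, Or.inl ⟨(Finset.univ : Finset (Fin n × Fin n)).toList, ?_⟩⟩
    · simpa [subtree, eq_comm] using hs'
    · simpa [subtree, child, gridTree, eq_comm] using hs
  | cons c q ih =>
    obtain ⟨s'', hs'', hc⟩ := Option.bind_eq_some_iff.1 hs'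
    have hchild : s'.child b = some s := by rw [subtree, hs'] at hs; exact hs
    have hne' : c :: q ≠ [false] := by
      intro h
      have hq : q = [] := by simpa using congrArg List.tail h
      subst hq
      obtain rfl : c = false := by simpa using h
      obtain rfl : leaf UX = s' := by simpa [subtree, child] using hs'
      simp [child] at hchild
    rcases ih c hne' s' s'' hs' hs'' with ⟨-, ⟨L, rfl⟩ | ⟨i, j, rfl⟩⟩ | ⟨i, j, -, rfl | rfl⟩ |
      ⟨i, j, -, rfl | rfl⟩
    · cases L with
      | nil => simp [spine, child] at hchild
      | cons a L =>
        obtain ⟨i, j⟩ := a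
        refine Or.inl ⟨Or.inr ⟨_, rfl⟩, ?_⟩
        cases b <;> simp only [spine, child, Option.some.injEq] at hchild
        · exact Or.inr ⟨i, j, hchild.symm⟩
        · exact Or.inl ⟨L, hchild.symm⟩
    · refine Or.inr (Or.inl ⟨i, j, rfl, ?_⟩)
      cases b <;> simp only [block, child, Option.some.injEq] at hchild
      · exact Or.inl hchild.symm
      · exact Or.inr hchild.symm
    · simp [child] at hchild
    · refine Or.inr (Or.inr ⟨i, j, rfl, ?_⟩)
      cases b <;> simp only [innerBlock, child, Option.some.injEq] at hchild
      · exact Or.inl hchild.symm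
      · exact Or.inr hchild.symm
    · simp [child] at hchild
    · simp [child] at hchild

/-- The variable `x` is to be kept on the edges to the children of a node with subtree `s`. -/
def KeptBelow (x : GridVar n) (s : LabeledTree (GridVar n)) : Prop :=
  match x with
  | X i => ∃ j, s = innerBlock i j
  | Y j => ∃ i, s = block i j ∨ s = innerBlock i j
  | _ => True

theorem IsSpine.not_keptBelow_X {s : LabeledTree (GridVar n)} (h : IsSpine s) (i : Fin n) :
    ¬ KeptBelow (X i) s := by
  rintro ⟨j, hj⟩
  rcases h with rfl | ⟨_ | ⟨⟨a, b⟩, L⟩, rfl⟩ <;> simp [innerBlock, spine, block] at hj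

theorem IsSpine.not_keptBelow_Y {s : LabeledTree (GridVar n)} (h : IsSpine s) (j : Fin n) :
    ¬ KeptBelow (Y j) s := by
  rintro ⟨i, hj | hj⟩ <;>
  rcases h with rfl | ⟨_ | ⟨⟨a, b⟩, L⟩, rfl⟩ <;> simp [innerBlock, spine, block] at hj

theorem block_inj {i j i' j' : Fin n} : block i j = block i' j' ↔ i = i' ∧ j = j' := by
  simp only [block, innerBlock, node.injEq, leaf.injEq, Y.injEq, X.injEq, Z.injEq]
  tauto

theorem innerBlock_inj {i j i' j' : Fin n} :
    innerBlock i j = innerBlock i' j' ↔ i = i' ∧ j = j' := by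
  simp only [innerBlock, node.injEq, leaf.injEq, X.injEq, Z.injEq]
  tauto

theorem block_ne_innerBlock {i j i' j' : Fin n} : block i j ≠ innerBlock i' j' := by
  simp [block, innerBlock]

/-- The variable `x` is to be kept on the edge `e`. -/
def KeptOn (x : GridVar n) (e : Sym2 (Addr (UX : GridVar n) (gridTree n))) : Prop :=
  ∃ p q b s, e = s(p, q) ∧ p.1 = b :: q.1 ∧
    (node (leaf UX) (gridTree n)).subtree q.1 = some s ∧ KeptBelow x s

variable {p q : Addr (UX : GridVar n) (gridTree n)} {b : Bool} {x : GridVar n}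
  {s s' : LabeledTree (GridVar n)}

theorem keptOn_iff (hq : p.1 = b :: q.1)
    (hs : (node (leaf UX) (gridTree n)).subtree q.1 = some s) :
    KeptOn x s(p, q) ↔ KeptBelow x s := by
  constructor
  · rintro ⟨p', q', b', s', he, hq', hs', h⟩
    rcases Sym2.eq_iff.1 he with ⟨rfl, rfl⟩ | ⟨rfl, rfl⟩
    · rw [hs] at hs'
      rwa [Option.some.inj hs']
    -- The longer address is the lower endpoint, so an edge cannot be read in both directions.
    · have h1 := congrArg List.length hq
      have h2 := congrArg List.length hq'
      simp at h1 h2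
      omega
  · exact fun h => ⟨p, q, b, s, rfl, hq, hs, h⟩

theorem edgeShape (hq : p.1 = b :: q.1)
    (hs : (node (leaf UX) (gridTree n)).subtree p.1 = some s)
    (hs' : (node (leaf UX) (gridTree n)).subtree q.1 = some s') : EdgeShape s s' :=
  edgeShape_of_subtree q.1 b (hq ▸ p.2.2) s s' (hq ▸ hs) hs'

theorem mem_vars_of_mem_sep (hq : p.1 = b :: q.1)
    (hs : (node (leaf UX) (gridTree n)).subtree p.1 = some s)
    (hx : x ∈ (gridJointree n).sep s(p, q)) : x ∈ s.vars (gridGraph n) := by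
  obtain ⟨i, j, w, w', hi, hj, hxw, hxw', hpi, hpj⟩ := exists_of_mem_sep hq hx
  exact factorVars_subset_vars_of_suffix (by simp [hq]) hs hi hpi hxw

/-- Only the factor of `Z i j` itself mentions it, and this factor is hosted by a single leaf. -/
theorem notMem_sep_Z (hq : p.1 = b :: q.1) (i j : Fin n) :
    Z i j ∉ (gridJointree n).sep s(p, q) := by
  intro hx
  obtain ⟨k, l, w, w', hk, hl, hxw, hxw', hpk, hpl⟩ := exists_of_mem_sep hq hx
  have key : ∀ w : GridVar n, Z i j ∈ (gridGraph n).factorVars w → w = Z i j := by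
    intro w hw
    cases w <;> simp_all [factorVars, gridGraph, GridVar.parents]
  rw [key w hxw] at hk
  rw [key w' hxw'] at hl
  rw [Addr.host_unique (count_leaves_gridTree_Z i j) hk hl] at hpk
  exact hpl hpk

theorem host_eq_none_of_node (hq : p.1 ≠ []) {l r : LabeledTree (GridVar n)}
    (hs : (node (leaf UX) (gridTree n)).subtree p.1 = some (node l r)) : p.host = none := by
  rw [Addr.host, Addr.rooted_of_ne hq, hs]
  rfl

/-- The endpoints of an edge from which a variable is to be removed are internal nodes. -/
theorem host_eq_none_of_not_keptOn (hq : p.1 = b :: q.1) (hk : ¬ KeptOn x s(p, q))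
    (hx : x ∈ (gridJointree n).sep s(p, q)) : p.host = none ∧ q.host = none := by
  obtain ⟨s, hs⟩ := p.exists_subtree
  obtain ⟨s', hs'⟩ := q.exists_subtree
  rw [keptOn_iff hq hs'] at hk
  have hv := mem_vars_of_mem_sep hq hs hx
  constructor
  · have hp : p.1 ≠ [] := by simp [hq]
    rcases edgeShape hq hs hs' with ⟨-, ⟨_ | ⟨⟨i, j⟩, L⟩, rfl⟩ | ⟨i, j, rfl⟩⟩ |
      ⟨i, j, rfl, rfl | rfl⟩ | ⟨i, j, rfl, rfl | rfl⟩
    · cases x <;>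
        simp [KeptBelow, spine, vars, factorVars, gridGraph, GridVar.parents] at hv hk
    · exact host_eq_none_of_node hp hs
    · exact host_eq_none_of_node hp hs
    · cases x <;>
        simp [KeptBelow, vars, factorVars, gridGraph, GridVar.parents, block_inj] at hv hk
      exact absurd hv.symm ((hk i).1 rfl)
    · exact host_eq_none_of_node hp hs
    · cases x <;>
        simp [KeptBelow, vars, factorVars, gridGraph, GridVar.parents, innerBlock_inj] at hv hk
      exact absurd hv.symm hk
    · cases x <;>
        simp [KeptBelow, vars, factorVars, gridGraph, GridVar.parents, innerBlock_inj] at hv hk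
      · exact absurd hv.symm hk
      · exact absurd hv.symm ((hk i).2 rfl)
  · by_cases hq0 : q.1 = []
    · obtain ⟨i, j, w, w', hi, hj, hxw, hxw', hpi, hpj⟩ := exists_of_mem_sep hq hx
      -- When `q` is the root, everything else lies below `p`; beyond the edge there is only the
      -- leaf of `U_X`, whose sole variable is always kept.
      have hj0 : j.1 = [] := by
        by_contra h0
        rcases List.eq_nil_or_concat j.1 with h | ⟨j', c, h⟩
        · exact h0 h
        rw [List.concat_eq_append] at h
        obtain ⟨sj, hsj⟩ := j.exists_subtree
        rw [h] at hsj
        cases c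
        · have := subtree_leaf_eq_some (subtree_node_append hsj)
          exact j.2.2 (by rw [h, this]; rfl)
        · refine hpj ⟨j', ?_⟩
          rw [h, hq, hq0]
          congr 2
          cases b
          · exact absurd (by rw [hq, hq0]) p.2.2
          · rfl
      rw [Addr.host_root hj0] at hj
      obtain rfl := Option.some.inj hj
      cases x <;> simp [KeptBelow, factorVars, gridGraph, GridVar.parents] at hxw' hk
    · refine (?_ : ∃ l r, s' = node l r).elim fun l ⟨r, h⟩ =>
        host_eq_none_of_node hq0 (h ▸ hs')
      cases s' with
      | leaf w => rw [hq, subtree, hs'] at hs; simp [child] at hs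
      | node l r => exact ⟨l, r, rfl⟩

/-- A leaf with a replica next to an internal node beyond which its variable is mentioned. -/
theorem mem_sep_of_leaf {l q m : Addr (UX : GridVar n) (gridTree n)} {v w : GridVar n}
    (hl : l.host = some v) (hm : m.host = some w) (hxv : x ∈ (gridGraph n).factorVars v)
    (hxw : x ∈ (gridGraph n).factorVars w)
    (hr : ((Addr.graph (UX : GridVar n) (gridTree n)).deleteEdges {s(q, l)}).Reachable q m) :
    x ∈ (gridJointree n).sep s(q, l) := by
  classical
  simp only [BinaryJointree.sep, Finset.mem_filter, Finset.mem_univ, true_and]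
  exact ⟨q, l, rfl, ⟨m, w, hr, hm, hxw⟩, ⟨l, v, SimpleGraph.Reachable.refl _, hl, hxv⟩⟩

/-- Supplies the replica required by `exists_thinned`; the sibling leaf `Z i j` mentions `X i`, so
the edge carries it. -/
theorem exists_replica_X {i j : Fin n} (hq : q.1 ≠ [])
    (hs : (node (leaf UX) (gridTree n)).subtree q.1 = some (innerBlock i j)) :
    ∃ l, (gridJointree n).tree.Adj q l ∧ (gridJointree n).host l = some (X i) ∧
      KeptOn (X i) s(q, l) ∧ X i ∈ (gridJointree n).sep s(q, l) := by
  obtain ⟨l, hl, hadj⟩ := q.exists_child hs false (fun h => absurd h hq)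
  obtain ⟨m, hm, hadj'⟩ := q.exists_child hs true (fun h => absurd h hq)
  have hhl : l.host = some (X i) := by
    rw [Addr.host_eq_some, Addr.rooted_of_ne (by simp [hl]), hl, subtree, hs]
    rfl
  have hhm : m.host = some (Z i j) := by
    rw [Addr.host_eq_some, Addr.rooted_of_ne (by simp [hm]), hm, subtree, hs]
    rfl
  have hlm : m ≠ l := by
    rintro rfl
    simpa using hl.symm.trans hm
  refine ⟨l, hadj, hhl, ?_, mem_sep_of_leaf hhl hhm (Finset.mem_insert_self _ _)
    (by simp [factorVars_Z]) ?_⟩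
  · rw [Sym2.eq_swap, keptOn_iff hl hs]
    exact ⟨j, rfl⟩
  · refine SimpleGraph.Adj.reachable ?_
    rw [SimpleGraph.deleteEdges_adj]
    refine ⟨hadj', ?_⟩
    simp [hlm, hadj.ne]

/-- The counterpart one level higher, where `Z i j` is reached through the root of the inner block.
-/
theorem exists_replica_Y {i j : Fin n} (hq : q.1 ≠ [])
    (hs : (node (leaf UX) (gridTree n)).subtree q.1 = some (block i j)) :
    ∃ l, (gridJointree n).tree.Adj q l ∧ (gridJointree n).host l = some (Y j) ∧
      KeptOn (Y j) s(q, l) ∧ Y j ∈ (gridJointree n).sep s(q, l) := by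
  obtain ⟨l, hl, hadj⟩ := q.exists_child hs false (fun h => absurd h hq)
  obtain ⟨k, hk, hadj'⟩ := q.exists_child hs true (fun h => absurd h hq)
  have hsk : (node (leaf UX) (gridTree n)).subtree k.1 = some (innerBlock i j) := by
    rw [hk, subtree, hs]
    rfl
  obtain ⟨m, hm, hadj''⟩ := k.exists_child hsk true (fun _ => rfl)
  have hhl : l.host = some (Y j) := by
    rw [Addr.host_eq_some, Addr.rooted_of_ne (by simp [hl]), hl, subtree, hs]
    rfl
  have hhm : m.host = some (Z i j) := by
    rw [Addr.host_eq_some, Addr.rooted_of_ne (by simp [hm]), hm, subtree, hsk]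
    rfl
  have hlk : k ≠ l := by
    rintro rfl
    simpa using hl.symm.trans hk
  refine ⟨l, hadj, hhl, ?_, mem_sep_of_leaf hhl hhm (Finset.mem_insert_self _ _)
    (by simp [factorVars_Z]) ?_⟩
  · rw [Sym2.eq_swap, keptOn_iff hl hs]
    exact ⟨i, Or.inl rfl⟩
  · refine SimpleGraph.Reachable.trans (v := k) (SimpleGraph.Adj.reachable ?_)
      (SimpleGraph.Adj.reachable ?_) <;> rw [SimpleGraph.deleteEdges_adj]
    · exact ⟨hadj', by simp [hlk, hadj.ne]⟩
    · refine ⟨hadj'', ?_⟩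
      simp [hlk, hadj'.ne']

theorem eq_of_not_keptOn (h : (gridJointree n).tree.Adj p q) (hk : ¬ KeptOn x s(p, q)) :
    (∃ i, x = X i) ∨ ∃ j, x = Y j := by
  have key : ∀ {p q : Addr (UX : GridVar n) (gridTree n)} {b : Bool}, p.1 = b :: q.1 →
      ¬ KeptOn x s(p, q) → (∃ i, x = X i) ∨ ∃ j, x = Y j := by
    intro p q b h hk
    obtain ⟨s, hs⟩ := q.exists_subtree
    rw [keptOn_iff h hs] at hk
    cases x <;> simp [KeptBelow] at hk ⊢
  obtain ⟨b, h | h⟩ := h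
  · exact key h hk
  · exact key h (by rwa [Sym2.eq_swap])

theorem exists_thinned_grid [DecidableEq (Addr (UX : GridVar n) (gridTree n))] :
    ∃ S, (gridJointree n).IsThinned S ∧
    ∀ e ∈ (gridJointree n).tree.edgeSet, ∀ x ∈ S e, x ∈ (gridJointree n).sep e ∧ KeptOn x e := by
  let _ : Fintype (Addr (UX : GridVar n) (gridTree n)) := Fintype.ofFinite _
  have hleaf : ∀ (x : GridVar n) i j, (gridJointree n).tree.Adj i j → ¬ KeptOn x s(i, j) →
      x ∈ (gridJointree n).sep s(i, j) → i.host = none := by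
    rintro x i j ⟨b, h | h⟩ hk hx
    · exact (host_eq_none_of_not_keptOn h hk hx).1
    · rw [Sym2.eq_swap] at hk hx
      exact (host_eq_none_of_not_keptOn h hk hx).2
  refine (gridJointree n).exists_thinned KeptOn _ ?_ hleaf ?_
  · intro x e he hk _
    induction e using Sym2.ind with
    | _ p q =>
    rcases eq_of_not_keptOn he hk with ⟨i, rfl⟩ | ⟨j, rfl⟩ <;> simp [gridGraph]
  · intro x i j k hij hk hx hik hkk
    obtain ⟨hi0, l, r, hs⟩ := Addr.host_eq_none (hleaf x i j hij hk hx)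
    have hparent : ∀ {p : Addr (UX : GridVar n) (gridTree n)} {b : Bool}, i.1 = b :: p.1 →
        ∃ s', (node (leaf UX) (gridTree n)).subtree p.1 = some s' ∧ EdgeShape (node l r) s' ∧
          ∀ x, KeptOn x s(i, p) ↔ KeptBelow x s' := by
      intro p b h
      obtain ⟨s', hs'⟩ := p.exists_subtree
      exact ⟨s', hs', edgeShape h hs hs', fun x => keptOn_iff h hs'⟩
    -- At the root of an inner block, `Y j'` is kept on all three edges. This excludes the one place
    -- where an edge keeps `Y j'` without a replica of its mechanism being adjacent.
    have hinner : ∀ i' j', node l r = innerBlock i' j' → x ≠ Y j' := by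
      rintro i' j' he rfl
      obtain ⟨b, h | h⟩ := hij
      · obtain ⟨s', -, hshape, hiff⟩ := hparent h
        rw [hiff] at hk
        rw [he] at hshape
        rcases hshape with ⟨-, ⟨_ | ⟨⟨_, _⟩, _⟩, h⟩ | ⟨_, _, h⟩⟩ | ⟨a, c, rfl, h | h⟩ | ⟨_, _, -, h | h⟩
        · simp [innerBlock, spine] at h
        · simp [innerBlock, spine, block] at h
        · exact block_ne_innerBlock h.symm
        · simp [innerBlock] at h
        · obtain ⟨-, rfl⟩ := innerBlock_inj.1 h
          exact hk ⟨a, Or.inl rfl⟩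
        · simp [innerBlock] at h
        · simp [innerBlock] at h
      · rw [Sym2.eq_swap, keptOn_iff h hs, he] at hk
        exact hk ⟨i', Or.inr rfl⟩
    have hxXY := eq_of_not_keptOn hij hk
    obtain ⟨b, h | h⟩ := hik
    · obtain ⟨s', -, hshape, hiff⟩ := hparent h
      rw [hiff] at hkk
      rcases hshape with ⟨hsp, -⟩ | ⟨a, c, rfl, h | h⟩ | ⟨_, _, -, h | h⟩
      · rcases hxXY with ⟨a, rfl⟩ | ⟨a, rfl⟩
        · exact absurd hkk (hsp.not_keptBelow_X a)
        · exact absurd hkk (hsp.not_keptBelow_Y a)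
      · simp at h
      · rcases hxXY with ⟨a', rfl⟩ | ⟨a', rfl⟩
        · obtain ⟨_, h⟩ := hkk
          exact absurd h block_ne_innerBlock
        · obtain ⟨i', h' | h'⟩ := hkk
          · obtain ⟨-, rfl⟩ := block_inj.1 h'
            exact absurd rfl (hinner _ _ h)
          · exact absurd h' block_ne_innerBlock
      · simp at h
      · simp at h
    · rw [Sym2.eq_swap, keptOn_iff h hs] at hkk
      rcases hxXY with ⟨a, rfl⟩ | ⟨a, rfl⟩
      · obtain ⟨c, hc⟩ := hkk
        rw [hc] at hs
        exact exists_replica_X hi0 hs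
      · obtain ⟨c, hc | hc⟩ := hkk
        · rw [hc] at hs
          exact exists_replica_Y hi0 hs
        · exact absurd rfl (hinner _ _ hc)

/-- The internal clusters lie in `{UX, UY}` on the caterpillar, in `{UX, UY, Y j}` at the root of a
block and in `{X i, UX, Y j}` at the root of an inner block. -/
theorem card_cluster_grid_le {S : Sym2 (Addr (UX : GridVar n) (gridTree n)) → Finset (GridVar n)}
    (hS : ∀ e ∈ (gridJointree n).tree.edgeSet, ∀ x ∈ S e,
      x ∈ (gridJointree n).sep e ∧ KeptOn x e) (p : Addr (UX : GridVar n) (gridTree n)) :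
    ((gridJointree n).cluster S p).card ≤ 3 := by
  rw [BinaryJointree.cluster]
  split
  · rename_i v _
    cases v with
    | Z i j => exact (card_factorVars_Z i j).le
    | _ => exact (Finset.card_insert_le _ _).trans (by simp [gridGraph, GridVar.parents])
  rename_i hp
  obtain ⟨hp0, l, r, hs⟩ := Addr.host_eq_none (show p.host = none from hp)
  obtain ⟨b, q', hq'⟩ := List.exists_cons_of_ne_nil hp0
  obtain ⟨q, rfl, hpq⟩ := p.exists_parent hq'
  obtain ⟨s', hs'⟩ := q.exists_subtree
  have hsep : ∀ k x, (gridJointree n).tree.Adj p k → x ∈ S s(p, k) →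
      x ∈ vars (gridGraph n) (node l r) ∧ (∀ i j, x ≠ Z i j) ∧
        (KeptBelow x s' ∨ KeptBelow x (node l r)) := by
    rintro k x hpk hx
    obtain ⟨hx, hkept⟩ := hS _ hpk x hx
    obtain ⟨c, h | h⟩ := hpk
    · refine ⟨mem_vars_of_mem_sep h hs hx, ?_, ?_⟩
      · rintro i j rfl
        exact notMem_sep_Z h i j hx
      · obtain rfl : k = q := Subtype.ext (by rw [hq'] at h; exact (List.cons.inj h).2.symm)
        exact Or.inl ((keptOn_iff h hs').1 hkept)
    · rw [Sym2.eq_swap] at hx hkept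
      refine ⟨?_, ?_, Or.inr ((keptOn_iff h hs).1 hkept)⟩
      · have hk : (node (leaf UX) (gridTree n)).subtree k.1 = some (if c then r else l) := by
          rw [h, subtree, hs]
          rfl
        have := mem_vars_of_mem_sep h hk hx
        cases c
        · exact Finset.mem_union_left _ this
        · exact Finset.mem_union_right _ this
      · rintro i j rfl
        exact notMem_sep_Z h i j hx
  classical
  have hbound : ∀ a b c : GridVar n, (∀ x, x ∈ vars (gridGraph n) (node l r) → (∀ i j, x ≠ Z i j) →
      (KeptBelow x s' ∨ KeptBelow x (node l r)) → x = a ∨ x = b ∨ x = c) →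
      (Finset.univ.filter fun x =>
        ∃ j, (gridJointree n).tree.Adj p j ∧ x ∈ S s(p, j)).card ≤ 3 := by
    intro a b c h
    refine (Finset.card_le_card (t := {a, b, c}) fun x hx => ?_).trans Finset.card_le_three
    obtain ⟨k, hpk, hx⟩ := (Finset.mem_filter.1 hx).2
    obtain ⟨h1, h2, h3⟩ := hsep k x hpk hx
    simpa using h x h1 h2 h3
  rcases edgeShape hq' hs hs' with ⟨hsp, ⟨L, h⟩ | ⟨i, j, h⟩⟩ | ⟨i, j, -, h | h⟩ | ⟨i, j, -, h | h⟩
  -- The third slot is only padding.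
  · refine hbound UX UY UY fun x _ hZ hk => ?_
    have hsp' : IsSpine (node l r) := Or.inr ⟨L, h⟩
    cases x with
    | UX => simp
    | UY => simp
    | X i => exact (hk.elim (hsp.not_keptBelow_X i) (hsp'.not_keptBelow_X i)).elim
    | Y i => exact (hk.elim (hsp.not_keptBelow_Y i) (hsp'.not_keptBelow_Y i)).elim
    | Z i j => exact absurd rfl (hZ i j)
  · refine hbound UX UY (Y j) fun x _ hZ hk => ?_
    rw [h] at hk
    cases x with
    | UX => simp
    | UY => simp
    | X i => exact (hk.elim (hsp.not_keptBelow_X i) fun ⟨_, h⟩ => block_ne_innerBlock h).elim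
    | Y j' =>
      obtain ⟨i', h | h⟩ := hk.resolve_left (hsp.not_keptBelow_Y j')
      · rw [(block_inj.1 h).2]
        simp
      · exact absurd h block_ne_innerBlock
    | Z i j => exact absurd rfl (hZ i j)
  · simp at h
  · refine hbound (X i) UX (Y j) fun x hx hZ _ => ?_
    rw [h] at hx
    simp only [innerBlock, vars, factorVars, gridGraph, GridVar.parents, Finset.mem_union,
      Finset.mem_insert, Finset.mem_singleton] at hx
    have := hZ i j
    tauto
  · simp at h
  · simp at h

theorem causalTreewidth_gridGraph (hn : 1 ≤ n) : (gridGraph n).causalTreewidth = 2 := by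
  classical
  apply le_antisymm
  · let _ : Fintype (Addr (UX : GridVar n) (gridTree n)) := Fintype.ofFinite _
    obtain ⟨S, hthin, hS⟩ := exists_thinned_grid (n := n)
    refine (causalTreewidth_le_width hthin).trans (Nat.cast_le (n := 2).2 ?_)
    exact Nat.sub_le_of_le_add (Finset.sup_le fun p _ => card_cluster_grid_le hS p)
  · refine le_sInf ?_
    rintro w ⟨N, _, _, T, S, -, rfl⟩
    -- Thinning does not affect leaf clusters, so the three variables of a `Z` factor bound every
    -- width from below.
    obtain ⟨i, hi⟩ := T.exists_host (Z ⟨0, hn⟩ ⟨0, hn⟩)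
    refine Nat.cast_le (m := 2).2 (Nat.le_sub_of_add_le ?_)
    refine le_trans ?_ (Finset.le_sup (f := fun i => (T.cluster S i).card) (Finset.mem_univ i))
    simp only [BinaryJointree.cluster, hi, card_factorVars_Z]
    exact le_rfl

end GridJointree

theorem mainTheorem1 :
    (∀ (V : Type*) [Fintype V] [DecidableEq V] [Nonempty V] (G : CausalGraph V),
      G.causalTreewidth ≤ G.treewidth) ∧
    (∀ n : ℕ, 1 ≤ n →
      Fintype.card (GridVar n) = n ^ 2 + 2 * n + 2 ∧
      (gridGraph n).treewidth = n + 1 ∧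
      (gridGraph n).causalTreewidth = 2) :=
  ⟨fun _ _ _ _ G => G.causalTreewidth_le_treewidth, fun n hn =>
    ⟨card_gridVar n, treewidth_gridGraph hn, causalTreewidth_gridGraph hn⟩⟩
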